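/- Let $X_1, X_2, \ldots$ be i.i.d. real random variables with the symmetric Laplace density $\frac12 e^{-|x|}$, $x\in\mathbb{R}$, and let $S_0 = 0$, $S_k = X_1 + \cdots + X_k$. Let $\tau^- = \inf\{k : S_k < 0\}$ be the first descending ladder time, which is almost surely finite, let $\nu = \tau^- - 1$, and let $M_0 \le M_1 \le \cdots \le M_\nu$ be the order statistics of $S_0, S_1, \ldots, S_\nu$ (so $M_0 = 0$). Let $(Z(t),\, t \ge 0)$ be a critical binary birth and death process, that is, a birth and death process on $\{0,1,2,\ldots\}$ with transitions $j \to j+1$ at rate $j$ and $j \to j-1$ at rate $j$, and all other transitions at rate $0$, whose initial state has the geometric$(1/2)$ distribution $\mathbb{P}(Z(0) = n) = 2^{-n-1}$ for $n \ge 0$. Almost surely, $Z$ has only finitely many death times, that is, times $t > 0$ with $Z(t) - Z(t-) = -1$; let $N$ be their number, let $T_k$ be the $k$-th of them for $1 \le k \le N$, and let $T_0 = 0$. Then the random finite sequences $(M_0, M_1, \ldots, M_\nu)$ and $(T_0, T_1, \ldots, T_N)$, including their random lengths, have the same distribution. Moreover, $$\mathbb{P}(M_\nu > t) = \frac{1}{2+t}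 \quad \text{for all } t > 0.$$ -/

import Mathlib

open MeasureTheory ProbabilityTheory Filter Topology
open scoped ENNReal NNReal

noncomputable section

namespace LaplaceWalk

/-- The symmetric Laplace distribution on `ℝ`, with density `x ↦ exp (-|x|) / 2`. -/
def laplaceMeasure : Measure ℝ :=
  volume.withDensity fun x => ENNReal.ofReal (1 / 2 * Real.exp (-|x|))

/-- The walk `S_0 = 0`, `S_k = x_1 + ⋯ + x_k`, where the `i`-th increment `x_i` is `x (i - 1)`. -/
def walk (x : ℕ → ℝ) (k : ℕ) : ℝ := ∑ i ∈ Finset.range k, x i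

/-- The first descending ladder time `τ⁻ = inf {k : S_k < 0}`
(with the value `0` if the walk never becomes negative). -/
def ladderTime (x : ℕ → ℝ) : ℕ := sInf {k : ℕ | walk x k < 0}

/-- `ν = τ⁻ - 1`. Since `S_0 = 0`, we have `τ⁻ ≥ 1` whenever the walk becomes negative. -/
def nu (x : ℕ → ℝ) : ℕ := ladderTime x - 1

/-- The order statistics of a finite family: its nondecreasing rearrangement, with repetitions. -/
def orderStat {n : ℕ} (f : Fin n → ℝ) : Fin n → ℝ := f ∘ Tuple.sort f

/-- The finite sequence `(M_0, …, M_ν)` of order statistics of `S_0, …, S_ν`,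
as an element of the disjoint union over `n` of the spaces `ℝ^(n+1)`. -/
def walkOrderStats (x : ℕ → ℝ) : Σ n : ℕ, (Fin (n + 1) → ℝ) :=
  ⟨nu x, orderStat fun i : Fin (nu x + 1) => walk x i⟩

/-- The largest order statistic `M_ν`. -/
def maxOrderStat (x : ℕ → ℝ) : ℝ := (walkOrderStats x).2 (Fin.last (walkOrderStats x).1)

/-- The death times of a path `z`: the times `t > 0` with `z(t) - z(t-) = -1`. -/
def deathTimes (z : ℝ≥0 → ℕ) : Set ℝ≥0 :=
  {t | 0 < t ∧ ∀ᶠ s in 𝓝[<] t, z s = z t + 1}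

/-- `0` for `k = 0`, and the `k`-th death time of the path `z` for `k ≥ 1`
(if there are at least `k` of them and they do not accumulate). -/
def deathTime (z : ℝ≥0 → ℕ) : ℕ → ℝ≥0
  | 0 => 0
  | k + 1 => sInf {t | t ∈ deathTimes z ∧ deathTime z k < t}

/-- The finite sequence consisting of `0` and of the successive death times of the path `z`. -/
def deathSequence (z : ℝ≥0 → ℕ) : Σ n : ℕ, (Fin (n + 1) → ℝ) :=
  ⟨(deathTimes z).ncard, fun k => (deathTime z k : ℝ)⟩

/-- For a birth and death process with birth rates `b` and death rates `d`, the joint law of the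
holding time in the state `j` and of the next state: the two are independent, the holding time is
exponential with rate `b j + d j`, and the next state is `j + 1` with probability
`b j / (b j + d j)` and `j - 1` with probability `d j / (b j + d j)`.
A state with `b j + d j = 0` is absorbing: it is held for an infinite time. -/
def holdJumpLaw (b d : ℕ → ℝ≥0) (j : ℕ) : Measure (ℝ≥0∞ × ℕ) :=
  if b j + d j = 0 then Measure.dirac (⊤, j)
  else ((expMeasure (b j + d j)).map ENNReal.ofReal).prod
    ((b j / (b j + d j)) • Measure.dirac (j + 1) + (d j / (b j + d j)) • Measure.dirac (j - 1))

/-- `holdJumpLaw` as a transition kernel. -/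
def holdJumpKernel (b d : ℕ → ℝ≥0) : Kernel ℕ (ℝ≥0∞ × ℕ) where
  toFun := holdJumpLaw b d
  measurable' := measurable_of_countable _

instance (b d : ℕ → ℝ≥0) : IsMarkovKernel (holdJumpKernel b d) := by
  refine ⟨fun j => ?_⟩
  change IsProbabilityMeasure (holdJumpLaw b d j)
  unfold holdJumpLaw
  split_ifs with h
  · infer_instance
  · have hpos : (0 : ℝ) < (b j : ℝ) + d j := by
      have : 0 < b j + d j := pos_iff_ne_zero.mpr h
      exact_mod_cast this
    have := isProbabilityMeasure_expMeasure hpos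
    have : IsProbabilityMeasure ((expMeasure ((b j : ℝ) + d j)).map ENNReal.ofReal) :=
      Measure.isProbabilityMeasure_map (by fun_prop)
    have : IsProbabilityMeasure ((b j / (b j + d j)) • Measure.dirac (j + 1)
        + (d j / (b j + d j)) • Measure.dirac (j - 1) : Measure ℕ) := by
      constructor
      have h1 : b j / (b j + d j) + d j / (b j + d j) = 1 := by
        rw [← add_div, div_self h]
      simp only [Measure.coe_add, Measure.coe_nnreal_smul_apply, Pi.add_apply, measure_univ,
        mul_one]
      exact_mod_cast h1
    infer_instance

/-- `Z` is a birth and death process on `ℕ` with transitions `j → j + 1` at rate `b j` and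
`j → j - 1` at rate `d j` (where `d 0 = 0`), with arbitrary initial law, in the usual description
by jump chain and holding times. Almost surely, `Z` is a right-continuous step path which starts in
the state `Y 0`, stays there for a time `H 0`, then jumps to `Y 1`, stays there for a time `H 1`,
and so on (the path is not constrained after an explosion). Given the states `Y 0, …, Y n` and the
holding times `H 0, …, H (n - 1)`, the pair of the next holding time `H n` and the next state
`Y (n + 1)` has the law `holdJumpLaw b d (Y n)`. -/
def IsBirthDeathProcess {Ω : Type*} [MeasurableSpace Ω] (b d : ℕ → ℝ≥0)
    (Z : ℝ≥0 → Ω → ℕ) (P : Measure Ω) : Prop :=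
  ∃ (Y : ℕ → Ω → ℕ) (H : ℕ → Ω → ℝ≥0∞),
    (∀ n : ℕ, HasCondDistrib (fun ω => (H n ω, Y (n + 1) ω))
      (fun ω => ((fun k : Fin n => H k ω), (fun k : Fin (n + 1) => Y k ω)))
      ((holdJumpKernel b d).comap
        (fun p : (Fin n → ℝ≥0∞) × (Fin (n + 1) → ℕ) => p.2 (Fin.last n)) (by fun_prop)) P) ∧
    ∀ᵐ ω ∂P, ∀ (n : ℕ) (t : ℝ≥0), ∑ k ∈ Finset.range n, H k ω ≤ t →
      (t : ℝ≥0∞) < ∑ k ∈ Finset.range (n + 1), H k ω → Z t ω = Y n ω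

end LaplaceWalk

end

namespace LaplaceWalk

instance Sigma.instBorelSpace {ι : Type*} [Countable ι] {X : ι → Type*}
    [∀ i, TopologicalSpace (X i)] [∀ i, MeasurableSpace (X i)] [∀ i, BorelSpace (X i)] :
    BorelSpace (Σ i, X i) := by
  refine ⟨le_antisymm ?_ ?_⟩
  · intro s hs
    have hs' : ∀ i, MeasurableSet (Sigma.mk i ⁻¹' s) := fun i => by
      have : (inferInstance : MeasurableSpace (Σ i, X i)) ≤
        (inferInstance : MeasurableSpace (X i)).map (Sigma.mk i) := iInf_le _ i
      exact this s hs
    have : s = ⋃ i, Sigma.mk i '' (Sigma.mk i ⁻¹' s) := by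
      ext ⟨i, x⟩
      simp only [Set.mem_iUnion, Set.mem_image, Set.mem_preimage]
      constructor
      · intro h; exact ⟨i, x, h, rfl⟩
      · rintro ⟨j, y, h, e⟩; rw [← e]; exact h
    rw [this]
    let : MeasurableSpace (Σ i, X i) := borel _
    have : BorelSpace (Σ i, X i) := ⟨rfl⟩
    exact MeasurableSet.iUnion fun i =>
      (Topology.IsOpenEmbedding.sigmaMk.measurableEmbedding).measurableSet_image.2 (hs' i)
  · refine MeasurableSpace.generateFrom_le fun s hs => ?_
    have : ∀ i, MeasurableSet (Sigma.mk i ⁻¹' s) := fun i =>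
      (isOpen_sigma_iff.1 hs i).measurableSet
    rw [MeasurableSpace.measurableSet_iInf]
    exact this

instance Sigma.instPolishSpace {ι : Type*} [Countable ι] {X : ι → Type*}
    [∀ i, TopologicalSpace (X i)] [∀ i, PolishSpace (X i)] : PolishSpace (Σ i, X i) where

/-- Finite nonempty sequences of real numbers. -/
abbrev FinSeq : Type := Σ n : ℕ, (Fin (n + 1) → ℝ)

/-- The product of the values of a function along a finite sequence. -/
def prodAlong {R : Type*} [CommMonoid R] (g : ℝ → R) (e : FinSeq) : R := ∏ i, g (e.2 i)

lemma continuous_prodAlong {g : ℝ → ℝ} (hg : Continuous g) : Continuous (prodAlong g) :=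
  continuous_sigma fun n => by
    change Continuous fun a : Fin (n + 1) → ℝ => ∏ i, g (a i)
    fun_prop

lemma measurable_prodAlong {g : ℝ → ℝ≥0∞} (hg : Measurable g) : Measurable (prodAlong g) := by
  intro s hs
  refine MeasurableSpace.measurableSet_iInf.2 fun n => ?_
  have : Measurable fun a : Fin (n + 1) → ℝ => ∏ i, g (a i) := by fun_prop
  exact this hs

lemma ofReal_prodAlong {g : ℝ → ℝ} (hg : ∀ x, 0 ≤ g x) (e : FinSeq) :
    ENNReal.ofReal (prodAlong g e) = prodAlong (fun x => ENNReal.ofReal (g x)) e :=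
  ENNReal.ofReal_prod_of_nonneg fun _ _ => hg _

lemma isClosed_monotone : IsClosed {e : FinSeq | Monotone e.2} := by
  rw [isClosed_sigma_iff]
  intro n
  change IsClosed {a : Fin (n + 1) → ℝ | Monotone a}
  simp only [Monotone, Set.ofPred_forall]
  exact isClosed_iInter fun i => isClosed_iInter fun j => isClosed_iInter fun _ =>
    isClosed_le (continuous_apply i) (continuous_apply j)

/-- Continuous functions with values in `[0, z]` for some `z < 1`. -/
def IsSubunit (g : ℝ → ℝ) : Prop := Continuous g ∧ ∃ z < 1, ∀ x, 0 ≤ g x ∧ g x ≤ z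

lemma IsSubunit.mul {f g : ℝ → ℝ} (hf : IsSubunit f) (hg : IsSubunit g) :
    IsSubunit fun x => f x * g x := by
  obtain ⟨cf, z, hz, hf⟩ := hf
  obtain ⟨cg, z', hz', hg⟩ := hg
  refine ⟨cf.mul cg, z, hz, fun x => ⟨mul_nonneg (hf x).1 (hg x).1, ?_⟩⟩
  exact (mul_le_of_le_one_right (hf x).1 ((hg x).2.trans hz'.le)).trans (hf x).2

lemma IsSubunit.norm_prodAlong_le {g : ℝ → ℝ} (hg : IsSubunit g) (e : FinSeq) :
    ‖prodAlong g e‖ ≤ 1 := by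
  obtain ⟨-, z, hz, hg⟩ := hg
  rw [prodAlong, Real.norm_of_nonneg (Finset.prod_nonneg fun i _ => (hg _).1)]
  exact Finset.prod_le_one (fun i _ => (hg _).1) fun i _ => (hg _).2.trans hz.le

/-- A finite multiset of reals is determined by its multiplicative functionals. -/
lemma eq_of_prodAlong_eq {e e' : FinSeq} (he : Monotone e.2) (he' : Monotone e'.2)
    (h : ∀ g, IsSubunit g → prodAlong g e = prodAlong g e') : e = e' := by
  classical
  obtain ⟨n, a⟩ := e
  obtain ⟨m, b⟩ := e'
  simp only [prodAlong] at he he' h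
  have hinj : Function.Injective fun k : ℕ => (1 / 2 : ℝ) ^ k :=
    pow_right_injective₀ (by norm_num) (by norm_num)
  have hnm : n = m := by
    have := h (fun _ => 1 / 2) ⟨continuous_const, 1 / 2, by norm_num, fun x => by norm_num⟩
    simp only [Finset.prod_const, Finset.card_univ, Fintype.card_fin] at this
    exact Nat.succ_injective (hinj this)
  subst hnm
  have hcount : ∀ x, (List.ofFn a).count x = (List.ofFn b).count x := by
    intro x
    set F : Set ℝ := (Set.range a ∪ Set.range b) \ {x} with hF
    have hFc : IsClosed F :=
      (((Set.finite_range a).union (Set.finite_range b)).subset Set.sdiff_subset).isClosed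
    obtain ⟨φ, h0, h1, h01⟩ := exists_continuous_zero_one_of_isClosed hFc
      (isClosed_singleton (x := x)) (Set.disjoint_sdiff_left)
    have hφ : ∀ c : Fin (n + 1) → ℝ, Set.range c ⊆ Set.range a ∪ Set.range b →
        ∏ i, (1 / 2 - 1 / 4 * φ (c i) : ℝ) = (1 / 2) ^ (n + 1 + (List.ofFn c).count x) := by
      intro c hc
      have : ∀ i, (1 / 2 - 1 / 4 * φ (c i) : ℝ) = 1 / 2 * if c i = x then 1 / 2 else 1 := by
        intro i
        split_ifs with hi
        · rw [hi, h1 rfl]; norm_num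
        · rw [h0 ⟨hc ⟨i, rfl⟩, hi⟩]; norm_num
      simp only [this, Finset.prod_mul_distrib, Finset.prod_const, Finset.card_univ,
        Fintype.card_fin, pow_add, Finset.prod_ite, one_pow, mul_one]
      congr 2
      rw [← Multiset.coe_count, ← Fin.univ_val_map, Multiset.count_map, Finset.card_def,
        Finset.filter_val]
      simp only [eq_comm]
    have := h (fun y => 1 / 2 - 1 / 4 * φ y) ⟨by fun_prop, 1 / 2, by norm_num, fun y => by
      have := h01 y; constructor <;> linarith [this.1, this.2]⟩
    rw [hφ a Set.subset_union_left, hφ b Set.subset_union_right] at this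
    exact Nat.add_left_cancel (hinj this)
  have hp : (List.ofFn a).Perm (List.ofFn b) := List.perm_iff_count.2 hcount
  have := List.ofFn_injective
    (hp.eq_of_pairwise' he.sortedLE_ofFn.pairwise he'.sortedLE_ofFn.pairwise)
  rw [this]

/-- Laws of nondecreasing finite sequences are determined by multiplicative functionals. -/
theorem measure_ext_of_prodAlong {μ ν : Measure FinSeq} [IsProbabilityMeasure μ]
    [IsProbabilityMeasure ν] (hμ : ∀ᵐ e ∂μ, Monotone e.2) (hν : ∀ᵐ e ∂ν, Monotone e.2)
    (h : ∀ g, IsSubunit g → ∫⁻ e, prodAlong (fun x => ENNReal.ofReal (g x)) e ∂μ =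
      ∫⁻ e, prodAlong (fun x => ENNReal.ofReal (g x)) e ∂ν) : μ = ν := by
  set S : Set FinSeq := {e | Monotone e.2} with hS
  have hSm : MeasurableSet S := isClosed_monotone.measurableSet
  have : PolishSpace S := isClosed_monotone.polishSpace
  have hmap : ∀ ρ : Measure FinSeq, (∀ᵐ e ∂ρ, Monotone e.2) →
      (ρ.comap ((↑) : S → FinSeq)).map (↑) = ρ := by
    intro ρ hρ
    rw [map_comap_subtype_coe hSm, Measure.restrict_eq_self_of_ae_mem (show ∀ᵐ e ∂ρ, e ∈ S from hρ)]
  have hfin : ∀ ρ : Measure FinSeq, IsProbabilityMeasure ρ →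
      IsFiniteMeasure (ρ.comap ((↑) : S → FinSeq)) := by
    intro ρ _
    infer_instance
  have := hfin μ inferInstance
  have := hfin ν inferInstance
  have hint : ∀ ρ : Measure FinSeq, (∀ᵐ e ∂ρ, Monotone e.2) → ∀ g, IsSubunit g →
      ∫ e : S, prodAlong g (e : FinSeq) ∂(ρ.comap (↑)) =
        (∫⁻ e, prodAlong (fun x => ENNReal.ofReal (g x)) e ∂ρ).toReal := by
    intro ρ hρ g hg
    have h0 : ∀ e, 0 ≤ prodAlong g e := fun e => Finset.prod_nonneg fun i _ => by
      obtain ⟨-, z, hz, hg⟩ := hg; exact (hg _).1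
    rw [← (MeasurableEmbedding.subtype_coe hSm).integral_map (prodAlong g), hmap ρ hρ,
      integral_eq_lintegral_of_nonneg_ae (Eventually.of_forall h0)
        (continuous_prodAlong hg.1).aestronglyMeasurable]
    congr 2 with e
    obtain ⟨-, z, hz, hg⟩ := hg
    exact ofReal_prodAlong (fun x => (hg x).1) e
  let Φ : {g // IsSubunit g} → BoundedContinuousFunction S ℝ := fun g =>
    BoundedContinuousFunction.ofNormedAddCommGroup (fun e : S => prodAlong g.1 (e : FinSeq))
      ((continuous_prodAlong g.2.1).comp continuous_subtype_val) 1
      fun e => g.2.norm_prodAlong_le _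
  let A : StarSubalgebra ℝ (BoundedContinuousFunction S ℝ) :=
    { Algebra.adjoin ℝ (Set.range Φ) with
      star_mem' := fun {f} hf => by
        have : star f = f := by ext; simp
        rwa [this] }
  suffices hcomap : μ.comap ((↑) : S → FinSeq) = ν.comap (↑) by
    rw [← hmap μ hμ, ← hmap ν hν, hcomap]
  refine ext_of_forall_mem_subalgebra_integral_eq_of_polish (𝕜 := ℝ) (A := A) ?_ ?_
  · intro e e' hee'
    by_contra hcon
    refine hee' (Subtype.ext (eq_of_prodAlong_eq e.2 e'.2 fun g hg => ?_))
    by_contra hne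
    refine hcon ⟨_, ⟨_, ⟨Φ ⟨g, hg⟩, Algebra.subset_adjoin ⟨_, rfl⟩, rfl⟩, rfl⟩, hne⟩
  · intro f hf
    replace hf : f ∈ Algebra.adjoin ℝ (Set.range Φ) := hf
    have hclosure : ∀ f ∈ Submonoid.closure (Set.range Φ), f = 1 ∨ f ∈ Set.range Φ := by
      intro f hf
      induction hf using Submonoid.closure_induction with
      | mem x hx => exact Or.inr hx
      | one => exact Or.inl rfl
      | mul x y _ _ hx hy =>
        rcases hx with rfl | ⟨g, rfl⟩
        · simpa using hy
        · rcases hy with rfl | ⟨g', rfl⟩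
          · right; simp
          · right
            refine ⟨⟨_, g.2.mul g'.2⟩, ?_⟩
            ext e
            rw [BoundedContinuousFunction.mul_apply]
            exact Finset.prod_mul_distrib (s := Finset.univ) (f := fun i => g.1 ((e : FinSeq).2 i))
              (g := fun i => g'.1 ((e : FinSeq).2 i))
    rw [← Subalgebra.mem_toSubmodule, Algebra.adjoin_eq_span] at hf
    induction hf using Submodule.span_induction with
    | mem x hx =>
      rcases hclosure x hx with rfl | ⟨g, rfl⟩
      · have : ∀ ρ : Measure FinSeq, IsProbabilityMeasure ρ → (∀ᵐ e ∂ρ, Monotone e.2) →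
            (ρ.comap ((↑) : S → FinSeq)).real Set.univ = 1 := by
          intro ρ _ hρ
          conv_rhs => rw [← probReal_univ (μ := ρ), ← hmap ρ hρ]
          rw [map_measureReal_apply measurable_subtype_coe MeasurableSet.univ, Set.preimage_univ]
        simp [this μ inferInstance hμ, this ν inferInstance hν]
      · exact (hint μ hμ g.1 g.2).trans ((congrArg _ (h g.1 g.2)).trans (hint ν hν g.1 g.2).symm)
    | zero => simp
    | add x y _ _ hx hy =>
      simp only [BoundedContinuousFunction.coe_add, Pi.add_apply]
      rw [integral_add (x.integrable _) (y.integrable _),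
        integral_add (x.integrable _) (y.integrable _), hx, hy]
    | smul a x _ hx =>
      simp only [BoundedContinuousFunction.coe_smul]
      rw [integral_smul, integral_smul, hx]

lemma integrableOn_exp_neg_mul {φ : ℝ → ℝ} (hφ : Measurable φ)
    (h1 : ∀ y, 0 ≤ y → |φ y| ≤ 1) : IntegrableOn (fun y => Real.exp (-y) * φ y) (Set.Ioi 0) := by
  refine Integrable.mono' (integrableOn_exp_neg_Ioi 0) (by fun_prop) ?_
  refine (ae_restrict_mem measurableSet_Ioi).mono fun y hy => ?_
  rw [norm_mul, Real.norm_eq_abs, Real.abs_exp, Real.norm_eq_abs]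
  exact mul_le_of_le_one_right (Real.exp_pos _).le (h1 y (le_of_lt hy))

lemma integral_exp_neg_abs_sub_mul {φ : ℝ → ℝ} (hφ : Measurable φ)
    (h1 : ∀ y, 0 ≤ y → |φ y| ≤ 1) {x : ℝ} (hx : 0 ≤ x) :
    ∫ y in Set.Ici 0, Real.exp (-|y - x|) * φ y =
      Real.exp (-x) * (∫ y in (0 : ℝ)..x, Real.exp y * φ y) +
        Real.exp x * ((∫ y in Set.Ioi 0, Real.exp (-y) * φ y) -
          ∫ y in (0 : ℝ)..x, Real.exp (-y) * φ y) := by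
  have hint := integrableOn_exp_neg_mul hφ h1
  have hsub : Set.Ioc 0 x ∪ Set.Ioi x = Set.Ioi 0 := Set.Ioc_union_Ioi_eq_Ioi hx
  have hJ : (∫ y in Set.Ioi 0, Real.exp (-y) * φ y) - ∫ y in (0 : ℝ)..x, Real.exp (-y) * φ y
      = ∫ y in Set.Ioi x, Real.exp (-y) * φ y := by
    rw [intervalIntegral.integral_of_le hx, ← hsub, setIntegral_union
      (Set.Ioc_disjoint_Ioi le_rfl) measurableSet_Ioi
      (hint.mono_set Set.Ioc_subset_Ioi_self) (hint.mono_set (Set.Ioi_subset_Ioi hx))]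
    ring
  have e1 : ∀ y ∈ Set.Ioc 0 x, Real.exp (-|y - x|) * φ y = Real.exp (-x) * (Real.exp y * φ y) := by
    intro y hy
    rw [abs_of_nonpos (sub_nonpos.2 hy.2), ← mul_assoc, ← Real.exp_add]
    congr 2; ring
  have e2 : ∀ y ∈ Set.Ioi x, Real.exp (-|y - x|) * φ y = Real.exp x * (Real.exp (-y) * φ y) := by
    intro y hy
    rw [abs_of_nonneg (sub_nonneg.2 (le_of_lt hy)), ← mul_assoc, ← Real.exp_add]
    congr 2; ring
  have hI : IntegrableOn (fun y => Real.exp y * φ y) (Set.Ioc 0 x) := by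
    refine Integrable.mono' (integrable_const (Real.exp x)) (by fun_prop) ?_
    refine (ae_restrict_mem measurableSet_Ioc).mono fun y hy => ?_
    rw [norm_mul, Real.norm_eq_abs, Real.abs_exp, Real.norm_eq_abs]
    exact (mul_le_of_le_one_right (Real.exp_pos _).le (h1 y hy.1.le)).trans
      (Real.exp_le_exp.2 hy.2)
  rw [integral_Ici_eq_integral_Ioi, ← hsub, setIntegral_union (Set.Ioc_disjoint_Ioi le_rfl)
    measurableSet_Ioi, setIntegral_congr_fun measurableSet_Ioc e1,
    setIntegral_congr_fun measurableSet_Ioi e2, integral_const_mul, integral_const_mul, hsub, hJ,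
    intervalIntegral.integral_of_le hx]
  · exact (integrableOn_congr_fun e1 measurableSet_Ioc).2 (hI.const_mul _)
  · exact (integrableOn_congr_fun e2 measurableSet_Ioi).2
      ((hint.mono_set (Set.Ioi_subset_Ioi hx)).const_mul _)

/-- A bounded solution `v` of the renewal equation of the walk killed by `g` and below `0` has
`1 + v' / v` as a solution with values in `[0, 1]` of the Riccati equation of the branching
process. -/
theorem exists_riccati {g v : ℝ → ℝ} (hg : Continuous g) (hg01 : ∀ x, 0 ≤ g x ∧ g x ≤ 1)
    (hvm : Measurable v) (hv01 : ∀ x, 0 ≤ x → 0 ≤ v x ∧ v x ≤ 1)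
    (hv : ∀ x, 0 ≤ x → v x = 1 / 2 * Real.exp (-x) +
      1 / 2 * ∫ y in Set.Ici 0, Real.exp (-|y - x|) * (g y * v y)) :
    ∃ u : ℝ → ℝ, (∀ x, 0 ≤ x → HasDerivAt u (2 * u x - g x - u x ^ 2) x) ∧
      (∀ x, 0 ≤ x → 0 ≤ u x ∧ u x ≤ 1) ∧ v 0 = 1 / (2 - u 0) := by
  -- a continuous version of `v`
  obtain ⟨V, hVc, hVv⟩ : ∃ V : ℝ → ℝ, Continuous V ∧ ∀ x, 0 ≤ x → V x = v x := by
    set φ : ℝ → ℝ := (Set.Ici 0).indicator fun y => g y * v y with hφ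
    have hφm : Measurable φ := (hg.measurable.mul hvm).indicator measurableSet_Ici
    have hφ1 : ∀ y, |φ y| ≤ 1 := by
      intro y
      by_cases hy : 0 ≤ y
      · rw [hφ, Set.indicator_of_mem (show y ∈ Set.Ici 0 from hy),
          abs_of_nonneg (mul_nonneg (hg01 y).1 (hv01 y hy).1)]
        exact mul_le_one₀ (hg01 y).2 (hv01 y hy).1 (hv01 y hy).2
      · rw [hφ, Set.indicator_of_notMem (by simpa using hy)]; simp
    have hii : ∀ (f : ℝ → ℝ), Continuous f → ∀ a b : ℝ,
        IntervalIntegrable (fun y => f y * φ y) volume a b := by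
      intro f hf a b
      have hb : IntervalIntegrable (fun y => φ y * f y) volume a b := by
        refine IntervalIntegrable.mono_fun (hf.intervalIntegrable a b) (by fun_prop) ?_
        refine Eventually.of_forall fun y => ?_
        simp only [norm_mul, Real.norm_eq_abs]
        exact mul_le_of_le_one_left (abs_nonneg _) (hφ1 y)
      simpa only [mul_comm] using hb
    refine ⟨fun x => 1 / 2 * Real.exp (-x) + 1 / 2 * (
      Real.exp (-x) * (∫ y in (0 : ℝ)..x, Real.exp y * φ y) +
        Real.exp x * ((∫ y in Set.Ioi 0, Real.exp (-y) * φ y) -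
          ∫ y in (0 : ℝ)..x, Real.exp (-y) * φ y)), ?_, ?_⟩
    · have c1 := intervalIntegral.continuous_primitive (hii Real.exp Real.continuous_exp) 0
      have c2 := intervalIntegral.continuous_primitive
        (hii (fun y => Real.exp (-y)) (by fun_prop)) 0
      fun_prop
    · intro x hx
      beta_reduce
      rw [hv x hx, ← integral_exp_neg_abs_sub_mul hφm (fun y _ => hφ1 y) hx]
      congr 2
      refine setIntegral_congr_fun measurableSet_Ici fun y hy => ?_
      simp only [hφ, Set.indicator_of_mem hy]
  have hV01 : ∀ x, 0 ≤ x → 0 ≤ V x ∧ V x ≤ 1 := fun x hx => by rw [hVv x hx]; exact hv01 x hx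
  set w : ℝ → ℝ := fun y => g y * V y with hw
  have hwc : Continuous w := hg.mul hVc
  have hw0 : ∀ y, 0 ≤ y → 0 ≤ w y := fun y hy => mul_nonneg (hg01 y).1 (hV01 y hy).1
  have hw1 : ∀ y, 0 ≤ y → |w y| ≤ 1 := fun y hy => by
    rw [abs_of_nonneg (hw0 y hy)]
    exact mul_le_one₀ (hg01 y).2 (hV01 y hy).1 (hV01 y hy).2
  set I : ℝ → ℝ := fun x => ∫ y in (0 : ℝ)..x, Real.exp y * w y with hI
  set J : ℝ → ℝ := fun x => (∫ y in Set.Ioi 0, Real.exp (-y) * w y) -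
    ∫ y in (0 : ℝ)..x, Real.exp (-y) * w y with hJ
  have hI' : ∀ x, HasDerivAt I (Real.exp x * w x) x := fun x =>
    ((Real.continuous_exp.mul hwc).integral_hasStrictDerivAt 0 x).hasDerivAt
  have hJ' : ∀ x, HasDerivAt J (-(Real.exp (-x) * w x)) x := fun x => by
    have : Continuous fun y => Real.exp (-y) * w y := by fun_prop
    exact (this.integral_hasStrictDerivAt 0 x).hasDerivAt.const_sub _
  set a : ℝ → ℝ := fun x => 1 / 2 * Real.exp (-x) * (1 + I x) with ha
  set c : ℝ → ℝ := fun x => 1 / 2 * Real.exp x * J x with hc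
  have hexp : ∀ x : ℝ, Real.exp (-x) * Real.exp x = 1 := fun x => by
    rw [← Real.exp_add]; simp
  have ha' : ∀ x, HasDerivAt a (-a x + w x / 2) x := fun x => by
    have h := (((hasDerivAt_neg x).exp.const_mul (1 / 2)).mul ((hI' x).const_add 1))
    refine h.congr_deriv ?_
    simp only [ha]
    linear_combination (w x / 2) * hexp x
  have hc' : ∀ x, HasDerivAt c (c x - w x / 2) x := fun x => by
    have h := (((Real.hasDerivAt_exp x).const_mul (1 / 2)).mul (hJ' x))
    refine h.congr_deriv ?_
    simp only [hc]
    linear_combination (-w x / 2) * hexp x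
  have hVac : ∀ x, 0 ≤ x → V x = a x + c x := by
    intro x hx
    rw [hVv x hx, hv x hx, setIntegral_congr_fun (g := fun y => Real.exp (-|y - x|) * w y)
      measurableSet_Ici (fun y hy => by simp only [hw, hVv y hy]),
      integral_exp_neg_abs_sub_mul hwc.measurable hw1 hx]
    simp only [ha, hc, hI, hJ]
    ring
  have ha0 : ∀ x, 0 ≤ x → 0 < a x := by
    intro x hx
    have : 0 ≤ I x := intervalIntegral.integral_nonneg hx fun y hy =>
      mul_nonneg (Real.exp_pos _).le (hw0 y hy.1)
    have := Real.exp_pos (-x)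
    simp only [ha]
    positivity
  have hc0 : ∀ x, 0 ≤ x → 0 ≤ c x := by
    intro x hx
    have hint := integrableOn_exp_neg_mul hwc.measurable hw1
    have : 0 ≤ J x := by
      simp only [hJ]
      rw [intervalIntegral.integral_of_le hx, sub_nonneg]
      refine setIntegral_mono_set hint ?_ Set.Ioc_subset_Ioi_self.eventuallyLE
      refine (ae_restrict_mem measurableSet_Ioi).mono fun y hy => ?_
      exact mul_nonneg (Real.exp_pos _).le (hw0 y (le_of_lt hy))
    have := Real.exp_pos x
    simp only [hc]
    positivity
  have hca : ∀ x, 0 ≤ x → c x ≤ a x := by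
    have hD' : ∀ x, HasDerivAt (fun x => c x - a x) (c x + a x - w x) x := fun x =>
      ((hc' x).sub (ha' x)).congr_deriv (by ring)
    have hD : MonotoneOn (fun x => c x - a x) (Set.Ici 0) := by
      refine monotoneOn_of_deriv_nonneg (convex_Ici 0)
        (fun x _ => (hD' x).continuousAt.continuousWithinAt)
        (fun x _ => (hD' x).differentiableAt.differentiableWithinAt) fun x hx => ?_
      rw [interior_Ici] at hx
      have hx : (0 : ℝ) ≤ x := le_of_lt hx
      rw [(hD' x).deriv]
      have h1 := hVac x hx
      have h2 : w x ≤ V x := mul_le_of_le_one_left (hV01 x hx).1 (hg01 x).2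
      linarith
    intro x₀ hx₀
    by_contra! hlt
    set p := c x₀ - a x₀ with hp
    have hp0 : 0 < p := sub_pos.2 hlt
    have hE' : ∀ x, HasDerivAt (fun x => a x + c x - p * x) (c x - a x - p) x := fun x =>
      (((ha' x).add (hc' x)).sub ((hasDerivAt_id x).const_mul p)).congr_deriv (by ring)
    have hE : MonotoneOn (fun x => a x + c x - p * x) (Set.Ici x₀) := by
      refine monotoneOn_of_deriv_nonneg (convex_Ici x₀)
        (fun x _ => (hE' x).continuousAt.continuousWithinAt)
        (fun x _ => (hE' x).differentiableAt.differentiableWithinAt) fun x hx => ?_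
      rw [interior_Ici] at hx
      have hx : x₀ ≤ x := le_of_lt hx
      rw [(hE' x).deriv, hp]
      exact sub_nonneg.2 (hD hx₀ (hx₀.trans hx) hx)
    have hx₁ : x₀ ≤ x₀ + 2 / p := by linarith [div_pos two_pos hp0]
    have h := hE Set.self_mem_Ici hx₁ hx₁
    simp only at h
    rw [← hVac _ hx₀, ← hVac _ (hx₀.trans hx₁)] at h
    have h1 := (hV01 _ hx₀).1
    have h2 := (hV01 _ (hx₀.trans hx₁)).2
    have h3 : p * (2 / p) = 2 := by field_simp
    nlinarith
  refine ⟨fun x => 2 * c x / (a x + c x), fun x hx => ?_, fun x hx => ?_, ?_⟩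
  · have h1 := ha0 x hx
    have h2 := hc0 x hx
    have hne : a x + c x ≠ 0 := by positivity
    refine (((hc' x).const_mul 2).div ((ha' x).add (hc' x)) hne).congr_deriv ?_
    have hwx : w x = g x * (a x + c x) := by simp only [hw, hVac x hx]
    simp only [hwx, Pi.add_apply]
    field_simp
    ring
  · have h1 := ha0 x hx
    have h2 := hc0 x hx
    refine ⟨by positivity, ?_⟩
    rw [div_le_one (by positivity)]
    linarith [hca x hx]
  · have hI0 : I 0 = 0 := by simp [hI]
    have ha00 : a 0 = 1 / 2 := by simp [ha, hI0]
    have h2 := hc0 0 le_rfl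
    rw [← hVv 0 le_rfl, hVac 0 le_rfl, ha00]
    have : (1 / 2 + c 0) ≠ 0 := by positivity
    have h3 : 2 - 2 * c 0 / (1 / 2 + c 0) = 1 / (1 / 2 + c 0) := by field_simp; ring
    beta_reduce
    rw [ha00, h3, one_div_one_div]

section WeightedOperator

variable {α β : Type*} [MeasurableSpace α] [MeasurableSpace β]

/-- The operator `f ↦ E[W(x, q) f(T(x, q))]`, where `q` has the law `κ x`. -/
noncomputable def wop (κ : Kernel α β) (W : α × β → ℝ≥0∞) (T : α × β → α) (f : α → ℝ≥0∞) (x : α) :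
    ℝ≥0∞ :=
  ∫⁻ q, W (x, q) * f (T (x, q)) ∂κ x

variable {κ : Kernel α β} {W : α × β → ℝ≥0∞} {T : α × β → α}
  {b f v : α → ℝ≥0∞}

lemma wop_mono {f f' : α → ℝ≥0∞} (h : ∀ x, f x ≤ f' x) (x : α) :
    wop κ W T f x ≤ wop κ W T f' x :=
  lintegral_mono fun _ => mul_le_mul_right (h _) _

lemma wop_sum {ι : Type*} (s : Finset ι) {F : ι → α → ℝ≥0∞} (hW : Measurable W)
    (hT : Measurable T) (hF : ∀ i, Measurable (F i)) (x : α) :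
    wop κ W T (fun y => ∑ i ∈ s, F i y) x = ∑ i ∈ s, wop κ W T (F i) x := by
  simp only [wop, Finset.mul_sum]
  refine lintegral_finsetSum _ fun i _ => ?_
  exact ((hW.mul ((hF i).comp hT)).comp measurable_prodMk_left)

variable [IsMarkovKernel κ]

lemma measurable_wop (hW : Measurable W) (hT : Measurable T) (hf : Measurable f) :
    Measurable (wop κ W T f) :=
  Measurable.lintegral_kernel_prod_right' (hW.mul (hf.comp hT))

lemma measurable_wop_iterate (hW : Measurable W) (hT : Measurable T) (hf : Measurable f) (n : ℕ) :
    Measurable ((wop κ W T)^[n] f) := by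
  induction n with
  | zero => exact hf
  | succ n ih => rw [Function.iterate_succ_apply']; exact measurable_wop hW hT ih

/-- The Neumann series `∑ Kⁿ b` of the operator `K = wop κ W T`. -/
noncomputable def neumann (κ : Kernel α β) (W : α × β → ℝ≥0∞) (T : α × β → α) (b : α → ℝ≥0∞)
    (x : α) : ℝ≥0∞ :=
  ∑' n, (wop κ W T)^[n] b x

lemma measurable_neumann (hW : Measurable W) (hT : Measurable T) (hb : Measurable b) :
    Measurable (neumann κ W T b) :=
  Measurable.tsum fun n => measurable_wop_iterate hW hT hb n

lemma neumann_eq (hW : Measurable W) (hT : Measurable T) (hb : Measurable b) (x : α) :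
    neumann κ W T b x = b x + wop κ W T (neumann κ W T b) x := by
  have : wop κ W T (neumann κ W T b) x = ∑' n, (wop κ W T)^[n + 1] b x := by
    simp only [Function.iterate_succ_apply', wop, neumann, ← ENNReal.tsum_mul_left]
    refine lintegral_tsum fun n => ?_
    exact ((hW.mul ((measurable_wop_iterate hW hT hb n).comp hT)).comp
      measurable_prodMk_left).aemeasurable
  rw [this, neumann, tsum_eq_zero_add' ENNReal.summable]
  rfl

lemma neumann_le_one (hW : Measurable W) (hT : Measurable T) (hb : Measurable b)
    (h : ∀ x, b x + wop κ W T 1 x ≤ 1) (x : α) : neumann κ W T b x ≤ 1 := by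
  have key : ∀ n x, ∑ k ∈ Finset.range n, (wop κ W T)^[k] b x ≤ 1 := by
    intro n
    induction n with
    | zero => simp
    | succ n ih =>
      intro x
      rw [Finset.sum_range_succ']
      simp only [Function.iterate_succ_apply', Function.iterate_zero, id]
      rw [← wop_sum _ hW hT (fun k => measurable_wop_iterate hW hT hb k), add_comm]
      exact (add_le_add_right (wop_mono ih x) _).trans (h x)
  rw [neumann, ENNReal.tsum_eq_iSup_nat]
  exact iSup_le fun n => key n x

/-- If the operator is a strict contraction, a bounded solution of `v = b + K v` is the sum of the
Neumann series. -/
lemma neumann_eq_of_contraction (hW : Measurable W) (hT : Measurable T) (hb : Measurable b)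
    (hv : Measurable v) {S : Set α} (hS : ∀ x ∈ S, ∀ᵐ q ∂κ x, W (x, q) ≠ 0 → T (x, q) ∈ S)
    {c : ℝ≥0∞} (hc : c < 1) (hc' : ∀ x ∈ S, wop κ W T 1 x ≤ c)
    (hv1 : ∀ x ∈ S, v x ≤ 1) (heq : ∀ x ∈ S, v x = b x + wop κ W T v x) {x : α} (hx : x ∈ S) :
    neumann κ W T b x = v x := by
  have hcongr : ∀ {f f' : α → ℝ≥0∞}, (∀ x ∈ S, f x = f' x) → ∀ x ∈ S,
      wop κ W T f x = wop κ W T f' x := by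
    intro f f' hff x hx
    refine lintegral_congr_ae ((hS x hx).mono fun q hq => ?_)
    by_cases h0 : W (x, q) = 0
    · simp [h0]
    · simp only [hff _ (hq h0)]
  have hsum : ∀ n, ∀ x ∈ S,
      v x = ∑ k ∈ Finset.range n, (wop κ W T)^[k] b x + (wop κ W T)^[n] v x := by
    intro n
    induction n with
    | zero => simp
    | succ n ih =>
      intro x hx
      rw [heq x hx, hcongr ih x hx, Finset.sum_range_succ']
      have : wop κ W T (fun y => ∑ k ∈ Finset.range n, (wop κ W T)^[k] b y +
          (wop κ W T)^[n] v y) x = wop κ W T (fun y => ∑ k ∈ Finset.range n,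
            (wop κ W T)^[k] b y) x + wop κ W T ((wop κ W T)^[n] v) x := by
        simp only [wop, mul_add]
        refine lintegral_add_right _ ?_
        exact (hW.mul ((measurable_wop_iterate hW hT hv n).comp hT)).comp measurable_prodMk_left
      rw [this, wop_sum _ hW hT (fun k => measurable_wop_iterate hW hT hb k)]
      simp only [Function.iterate_succ_apply', Function.iterate_zero, id]
      ring
  have hrem : ∀ n, ∀ x ∈ S, (wop κ W T)^[n] v x ≤ c ^ n := by
    intro n
    induction n with
    | zero => simpa using hv1
    | succ n ih =>
      intro x hx
      rw [Function.iterate_succ_apply']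
      calc wop κ W T ((wop κ W T)^[n] v) x ≤ ∫⁻ q, W (x, q) * c ^ n ∂κ x := by
            refine lintegral_mono_ae ((hS x hx).mono fun q hq => ?_)
            by_cases h0 : W (x, q) = 0
            · simp [h0]
            · exact mul_le_mul_right (ih _ (hq h0)) _
        _ = wop κ W T 1 x * c ^ n := by
            rw [lintegral_mul_const _ (show Measurable fun q => W (x, q) from
              hW.comp measurable_prodMk_left)]
            simp [wop]
        _ ≤ c ^ (n + 1) := by
            rw [pow_succ']
            exact mul_le_mul_left (hc' x hx) _
  refine le_antisymm ?_ ?_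
  · rw [neumann, ENNReal.tsum_eq_iSup_nat]
    exact iSup_le fun n => le_self_add.trans (hsum n x hx).ge
  · have h1 : Tendsto (fun n => neumann κ W T b x + c ^ n) atTop
        (𝓝 (neumann κ W T b x + 0)) :=
      tendsto_const_nhds.add (ENNReal.tendsto_pow_atTop_nhds_zero_of_lt_one hc)
    rw [add_zero] at h1
    refine ge_of_tendsto' h1 fun n => ?_
    rw [hsum n x hx]
    exact add_le_add (ENNReal.sum_le_tsum _) (hrem n x hx)

end WeightedOperator

lemma integrable_exp_neg_abs : Integrable fun x : ℝ => Real.exp (-|x|) := by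
  rw [← integrableOn_univ, ← Set.Iic_union_Ioi (a := (0 : ℝ))]
  refine IntegrableOn.union ?_ ?_
  · refine (integrableOn_congr_fun (fun x hx => ?_) measurableSet_Iic).2 (integrableOn_exp_Iic 0)
    rw [abs_of_nonpos hx, neg_neg]
  · refine (integrableOn_congr_fun (fun x hx => ?_) measurableSet_Ioi).2
      (integrableOn_exp_neg_Ioi 0)
    rw [abs_of_pos hx]

instance : IsProbabilityMeasure laplaceMeasure := by
  constructor
  rw [laplaceMeasure, withDensity_apply _ MeasurableSet.univ, setLIntegral_univ,
    ← ofReal_integral_eq_lintegral_ofReal (integrable_exp_neg_abs.const_mul _)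
      (Eventually.of_forall fun x => by positivity), integral_const_mul,
    integral_comp_abs (f := fun x => Real.exp (-x)), integral_exp_neg_Ioi]
  simp

lemma lintegral_laplace {f : ℝ → ℝ≥0∞} (hf : Measurable f) (x : ℝ) :
    ∫⁻ ξ, f (x + ξ) ∂laplaceMeasure =
      ∫⁻ y, ENNReal.ofReal (1 / 2 * Real.exp (-|y - x|)) * f y := by
  rw [laplaceMeasure, lintegral_withDensity_eq_lintegral_mul _ (by fun_prop) (by fun_prop),
    ← lintegral_add_left_eq_self (fun y => ENNReal.ofReal (1 / 2 * Real.exp (-|y - x|)) * f y) x]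
  simp

/-- The probability that a step of the walk leads from `x` to the negative half-line. -/
noncomputable def exitProb (x : ℝ) : ℝ≥0∞ := laplaceMeasure {ξ | x + ξ < 0}

lemma measurable_exitProb : Measurable exitProb :=
  measurable_measure_prodMk_left (measurableSet_lt (by fun_prop) measurable_const :
    MeasurableSet {p : ℝ × ℝ | p.1 + p.2 < 0})

lemma exitProb_eq {x : ℝ} (hx : 0 ≤ x) : exitProb x = ENNReal.ofReal (1 / 2 * Real.exp (-x)) := by
  have h1 : exitProb x = ∫⁻ ξ, (Set.Iio 0).indicator 1 (x + ξ) ∂laplaceMeasure := by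
    have : MeasurableSet {ξ : ℝ | x + ξ < 0} := measurableSet_lt (by fun_prop) measurable_const
    rw [exitProb, ← lintegral_indicator_one this]
    rfl
  rw [h1, lintegral_laplace (measurable_one.indicator measurableSet_Iio)]
  have h2 : ∀ y : ℝ, ENNReal.ofReal (1 / 2 * Real.exp (-|y - x|)) * (Set.Iio 0).indicator 1 y =
      (Set.Iio (0 : ℝ)).indicator
        (fun y => ENNReal.ofReal (1 / 2 * Real.exp (-x) * Real.exp y)) y := by
    intro y
    by_cases hy : y < 0
    · rw [Set.indicator_of_mem (show y ∈ Set.Iio 0 from hy),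
        Set.indicator_of_mem (show y ∈ Set.Iio 0 from hy), abs_of_nonpos (by linarith),
        Pi.one_apply, mul_one, mul_assoc, ← Real.exp_add]
      congr 3; ring
    · rw [Set.indicator_of_notMem (show y ∉ Set.Iio 0 from hy),
        Set.indicator_of_notMem (show y ∉ Set.Iio 0 from hy), mul_zero]
  rw [lintegral_congr h2, lintegral_indicator measurableSet_Iio,
    setLIntegral_congr Iio_ae_eq_Iic, ← ofReal_integral_eq_lintegral_ofReal
      ((integrableOn_exp_Iic 0).const_mul _) (Eventually.of_forall fun x => by positivity),
    integral_const_mul, integral_exp_Iic_zero, mul_one]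

/-- The law of the sequence of increments of the walk. -/
noncomputable abbrev incrementLaw : Measure (ℕ → ℝ) := Measure.infinitePi fun _ => laplaceMeasure

lemma lintegral_increment {n : ℕ} {F : (ℕ → ℝ) × ℝ → ℝ≥0∞} (hF : Measurable F)
    (hn : ∀ x ξ, F (x, ξ) = F (fun i => if i < n then x i else 0, ξ)) :
    ∫⁻ x, F (x, x n) ∂incrementLaw = ∫⁻ x, ∫⁻ ξ, F (x, ξ) ∂laplaceMeasure ∂incrementLaw := by
  set tr : (ℕ → ℝ) → ℕ → ℝ := fun x i => if i < n then x i else 0 with htr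
  have htrm : Measurable tr := by
    refine measurable_pi_lambda _ fun i => ?_
    by_cases h : i < n
    · simp only [htr, h, if_true]; fun_prop
    · simp only [htr, h, if_false]; fun_prop
  have hI : iIndepFun (fun (i : ℕ) (x : ℕ → ℝ) => x i) incrementLaw :=
    iIndepFun_infinitePi (X := fun _ x => x) (fun _ => measurable_id)
  have hind : IndepFun tr (fun x => x n) incrementLaw := by
    have h := hI.indepFun_finset (Finset.range n) {n} (by simp) (fun i => by fun_prop)
    let e : (Finset.range n → ℝ) → ℕ → ℝ := fun y i =>
      if h : i < n then y ⟨i, Finset.mem_range.2 h⟩ else 0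
    have he : Measurable e := by
      refine measurable_pi_lambda _ fun i => ?_
      by_cases h : i < n
      · simp only [e, h, dif_pos]; fun_prop
      · simp only [e, h, dif_neg, not_false_eq_true]; fun_prop
    have h' := h.comp he (measurable_pi_apply (⟨n, by simp⟩ : ({n} : Finset ℕ)))
    have h1 : tr = e ∘ fun x (i : Finset.range n) => x i := by
      ext x i
      simp [htr, e]
    rw [h1]
    exact h'
  have hmap := (indepFun_iff_map_prod_eq_prod_map_map htrm.aemeasurable
    (measurable_pi_apply n).aemeasurable).1 hind
  rw [show (Measure.map (fun x : ℕ → ℝ => x n) incrementLaw) = laplaceMeasure from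
    Measure.infinitePi_map_eval _ n] at hmap
  calc ∫⁻ x, F (x, x n) ∂incrementLaw = ∫⁻ x, F (tr x, x n) ∂incrementLaw :=
        lintegral_congr fun x => hn x _
    _ = ∫⁻ p, F p ∂(incrementLaw.map fun x => (tr x, x n)) :=
        (lintegral_map hF (by fun_prop)).symm
    _ = ∫⁻ x, ∫⁻ ξ, F (tr x, ξ) ∂laplaceMeasure ∂incrementLaw := by
        rw [hmap, lintegral_prod _ hF.aemeasurable, lintegral_map (by fun_prop) htrm]
    _ = _ := lintegral_congr fun x => lintegral_congr fun ξ => (hn x ξ).symm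

@[fun_prop]
lemma measurable_walk (k : ℕ) : Measurable fun x : ℕ → ℝ => walk x k := by
  unfold walk; fun_prop

lemma walk_succ (x : ℕ → ℝ) (k : ℕ) : walk x (k + 1) = walk x k + x k :=
  Finset.sum_range_succ _ _

lemma walk_congr {x y : ℕ → ℝ} {k : ℕ} (h : ∀ i < k, x i = y i) : walk x k = walk y k :=
  Finset.sum_congr rfl fun i hi => h i (Finset.mem_range.1 hi)

/-- The weight of a step of the walk killed below `0`. -/
noncomputable def walkW (G : ℝ → ℝ≥0∞) (p : ℝ × ℝ) : ℝ≥0∞ := (Set.Ici 0).indicator G (p.1 + p.2)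

/-- The Neumann series of the walk killed below `0`, started at `x`. -/
noncomputable def walkV (G : ℝ → ℝ≥0∞) (x : ℝ) : ℝ≥0∞ :=
  neumann (Kernel.const ℝ laplaceMeasure) (walkW G) (fun p => p.1 + p.2) exitProb x

lemma measurable_walkW {G : ℝ → ℝ≥0∞} (hG : Measurable G) : Measurable (walkW G) :=
  (hG.indicator measurableSet_Ici).comp (measurable_fst.add measurable_snd)

lemma lintegral_walk_weight {G : ℝ → ℝ≥0∞} (hG : Measurable G) (n : ℕ) :
    ∀ {f : ℝ → ℝ≥0∞}, Measurable f →
    ∫⁻ x, (∏ i ∈ Finset.range n, (Set.Ici 0).indicator G (walk x (i + 1))) * f (walk x n)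
      ∂incrementLaw =
    (wop (Kernel.const ℝ laplaceMeasure) (walkW G) (fun p => p.1 + p.2))^[n] f 0 := by
  have hG' : Measurable ((Set.Ici 0).indicator G) := hG.indicator measurableSet_Ici
  induction n with
  | zero => intro f _; simp [walk]
  | succ n ih =>
    intro f hf
    rw [Function.iterate_succ_apply, ← ih (measurable_wop (measurable_walkW hG) (by fun_prop) hf)]
    have h := lintegral_increment (n := n) (F := fun p =>
      (∏ i ∈ Finset.range n, (Set.Ici 0).indicator G (walk p.1 (i + 1))) *
        ((Set.Ici 0).indicator G (walk p.1 n + p.2) * f (walk p.1 n + p.2))) (by fun_prop) ?_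
    · simp only [Finset.prod_range_succ, mul_assoc, walk_succ] at h ⊢
      rw [h]
      refine lintegral_congr fun x => ?_
      rw [lintegral_const_mul _ (by fun_prop)]
      rfl
    · intro x ξ
      have : ∀ k ≤ n, walk (fun i => if i < n then x i else 0) k = walk x k := fun k hk =>
        walk_congr fun i hi => if_pos (hi.trans_le hk)
      simp only
      rw [this n le_rfl]
      congr 1
      refine Finset.prod_congr rfl fun i hi => ?_
      rw [this (i + 1) (Finset.mem_range.1 hi)]

lemma tsum_walk_weight {G : ℝ → ℝ≥0∞} (x : ℕ → ℝ) [Decidable (∃ k, walk x k < 0)] :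
    G 0 * ∑' n, (∏ i ∈ Finset.range n, (Set.Ici 0).indicator G (walk x (i + 1))) *
      (Set.Iio 0).indicator 1 (walk x (n + 1)) =
    if ∃ k, walk x k < 0 then prodAlong G (walkOrderStats x) else 0 := by
  split_ifs with h
  · have hne : {k : ℕ | walk x k < 0}.Nonempty := h
    have hmem : walk x (ladderTime x) < 0 := Nat.sInf_mem hne
    have hlt : ∀ k < ladderTime x, 0 ≤ walk x k := fun k hk =>
      not_lt.1 (Nat.notMem_of_lt_sInf hk)
    have hpos : ladderTime x ≠ 0 := fun h0 => by
      rw [h0] at hmem; simp [walk] at hmem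
    have hnu : nu x + 1 = ladderTime x := by unfold nu; omega
    rw [tsum_eq_single (nu x)]
    · have h1 : prodAlong G (walkOrderStats x) = ∏ i : Fin (nu x + 1), G (walk x i) :=
        Equiv.prod_comp (Tuple.sort fun i : Fin (nu x + 1) => walk x i)
          (fun i => G (walk x i))
      rw [h1, Fin.prod_univ_eq_prod_range (fun i => G (walk x i)), Finset.prod_range_succ', hnu,
        Set.indicator_of_mem (show walk x _ ∈ Set.Iio 0 from hmem), Pi.one_apply,
        mul_one, mul_comm]
      congr 1
      · refine Finset.prod_congr rfl fun i hi => ?_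
        rw [Set.indicator_of_mem]
        exact hlt _ (by have := Finset.mem_range.1 hi; omega)
    · intro n hn
      rcases lt_or_gt_of_ne hn with hn | hn
      · rw [Set.indicator_of_notMem (by simpa using hlt (n + 1) (by omega)), mul_zero]
      · rw [Finset.prod_eq_zero (Finset.mem_range.2 hn), zero_mul]
        rw [hnu, Set.indicator_of_notMem]
        simpa using hmem
  · push Not at h
    have : ∀ n, (Set.Iio 0).indicator (1 : ℝ → ℝ≥0∞) (walk x n) = 0 := fun n =>
      Set.indicator_of_notMem (by simpa using h n) _
    simp [this]

open Classical in
/-- The multiplicative functional of the points visited by the walk before it gets negative. -/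
theorem lintegral_prodAlong_walk {G : ℝ → ℝ≥0∞} (hG : Measurable G) :
    ∫⁻ x, (if ∃ k, walk x k < 0 then prodAlong G (walkOrderStats x) else 0) ∂incrementLaw =
      G 0 * walkV G 0 := by
  have hG' : Measurable ((Set.Ici 0).indicator G) := hG.indicator measurableSet_Ici
  have hI : Measurable ((Set.Iio (0 : ℝ)).indicator (1 : ℝ → ℝ≥0∞)) :=
    measurable_one.indicator measurableSet_Iio
  simp_rw [← tsum_walk_weight]
  rw [lintegral_const_mul _ (by fun_prop), lintegral_tsum (fun n => by fun_prop), walkV, neumann]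
  congr 2 with n
  rw [← lintegral_walk_weight hG n measurable_exitProb]
  have h := lintegral_increment (n := n) (F := fun p =>
      (∏ i ∈ Finset.range n, (Set.Ici 0).indicator G (walk p.1 (i + 1))) *
        (Set.Iio 0).indicator 1 (walk p.1 n + p.2)) (by fun_prop) ?_
  · simp only [walk_succ] at h ⊢
    rw [h]
    refine lintegral_congr fun x => ?_
    rw [lintegral_const_mul _ (by fun_prop)]
    congr 1
    have : MeasurableSet {ξ : ℝ | walk x n + ξ < 0} :=
      measurableSet_lt (by fun_prop) measurable_const
    rw [exitProb, ← lintegral_indicator_one this]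
    rfl
  · intro x ξ
    have : ∀ k ≤ n, walk (fun i => if i < n then x i else 0) k = walk x k := fun k hk =>
      walk_congr fun i hi => if_pos (hi.trans_le hk)
    simp only
    rw [this n le_rfl]
    congr 1
    refine Finset.prod_congr rfl fun i hi => ?_
    rw [this (i + 1) (Finset.mem_range.1 hi)]

lemma measurable_nat_sInf {α : Type*} [MeasurableSpace α] {q : α → ℕ → Prop}
    (hq : ∀ n, MeasurableSet {x | q x n}) : Measurable fun x => sInf {n | q x n} := by
  classical
  refine measurable_to_countable' fun m => ?_
  have : (fun x => sInf {n | q x n}) ⁻¹' {m} =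
      ({x | q x m} ∩ ⋂ k, ⋂ (_ : k < m), {x | q x k}ᶜ) ∪
        (if m = 0 then ⋂ k, {x | q x k}ᶜ else ∅) := by
    ext x
    simp only [Set.mem_preimage, Set.mem_singleton_iff, Set.mem_union, Set.mem_inter_iff,
      Set.mem_iInter, Set.mem_compl_iff, Set.mem_ofPred_eq]
    constructor
    · rintro rfl
      rcases Set.eq_empty_or_nonempty {n | q x n} with h | h
      · right
        rw [h, Nat.sInf_empty, if_pos rfl]
        simp only [Set.mem_iInter]
        exact fun k hk => (Set.eq_empty_iff_forall_notMem.1 h k) hk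
      · exact Or.inl ⟨Nat.sInf_mem h, fun k hk => Nat.notMem_of_lt_sInf hk⟩
    · rintro (⟨h1, h2⟩ | h)
      · refine le_antisymm (Nat.sInf_le h1) (le_of_not_gt fun hlt => h2 _ hlt ?_)
        exact Nat.sInf_mem (s := {n | q x n}) ⟨m, h1⟩
      · split_ifs at h with hm
        · rw [Nat.sInf_eq_zero.2, hm]
          right
          rw [Set.eq_empty_iff_forall_notMem]
          simp only [Set.mem_iInter] at h
          exact fun k hk => h k hk
        · exact h.elim
  rw [this]
  refine ((hq m).inter (MeasurableSet.iInter fun k => MeasurableSet.iInter fun _ =>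
    (hq k).compl)).union ?_
  split_ifs
  · exact MeasurableSet.iInter fun k => (hq k).compl
  · exact MeasurableSet.empty

lemma measurable_sigma_mk {α : Type*} [MeasurableSpace α] {X : ℕ → Type*}
    [∀ n, MeasurableSpace (X n)] {N : α → ℕ} (hN : Measurable N) {F : ∀ n, α → X n}
    (hF : ∀ n, Measurable (F n)) : Measurable fun x => (⟨N x, F (N x) x⟩ : Σ n, X n) := by
  intro s hs
  have : (fun x => (⟨N x, F (N x) x⟩ : Σ n, X n)) ⁻¹' s =
      ⋃ n, N ⁻¹' {n} ∩ F n ⁻¹' (Sigma.mk n ⁻¹' s) := by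
    ext x
    simp
  rw [this]
  exact MeasurableSet.iUnion fun n => (hN (measurableSet_singleton n)).inter
    (hF n (MeasurableSpace.measurableSet_iInf.1 hs n))

lemma measurable_orderStat (n : ℕ) : Measurable (orderStat : (Fin n → ℝ) → Fin n → ℝ) := by
  intro s hs
  have : (orderStat : (Fin n → ℝ) → Fin n → ℝ) ⁻¹' s =
      ⋃ σ : Equiv.Perm (Fin n), {f | σ = Tuple.sort f} ∩ {f | f ∘ σ ∈ s} := by
    ext f
    simp [orderStat]
  rw [this]
  refine MeasurableSet.iUnion fun σ => MeasurableSet.inter ?_ ?_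
  · simp only [Tuple.eq_sort_iff, Monotone, Function.comp_apply]
    measurability
  · have : Measurable fun f : Fin n → ℝ => f ∘ σ :=
      measurable_pi_lambda _ fun i => measurable_pi_apply _
    exact this hs

lemma measurable_nu : Measurable nu :=
  (measurable_from_top (f := fun n : ℕ => n - 1)).comp (measurable_nat_sInf fun n =>
    measurableSet_lt (measurable_walk n) measurable_const)

lemma measurable_walkOrderStats : Measurable walkOrderStats :=
  measurable_sigma_mk (X := fun n => Fin (n + 1) → ℝ) measurable_nu
    (F := fun n x => orderStat fun i : Fin (n + 1) => walk x i)
    fun n => (measurable_orderStat _).comp (by fun_prop)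

lemma monotone_walkOrderStats (x : ℕ → ℝ) : Monotone (walkOrderStats x).2 :=
  Tuple.monotone_sort fun i : Fin (nu x + 1) => walk x i

lemma measurableSet_exists_walk_neg : MeasurableSet {x : ℕ → ℝ | ∃ k, walk x k < 0} := by
  simp only [Set.ofPred_exists]
  exact MeasurableSet.iUnion fun k => measurableSet_lt (measurable_walk k) measurable_const

lemma measurable_maxOrderStat : Measurable maxOrderStat := by
  have : Measurable fun e : FinSeq => e.2 (Fin.last e.1) := by
    intro s hs
    exact MeasurableSpace.measurableSet_iInf.2 fun n => measurable_pi_apply (Fin.last n) hs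
  exact this.comp measurable_walkOrderStats

lemma wop_walk {G f : ℝ → ℝ≥0∞} (hG : Measurable G) (hf : Measurable f) (x : ℝ) :
    wop (Kernel.const ℝ laplaceMeasure) (walkW G) (fun p => p.1 + p.2) f x =
      ∫⁻ y in Set.Ici 0, ENNReal.ofReal (1 / 2 * Real.exp (-|y - x|)) * (G y * f y) := by
  have h := lintegral_laplace ((hG.mul hf).indicator (measurableSet_Ici (a := (0 : ℝ)))) x
  rw [← lintegral_indicator measurableSet_Ici]
  convert h using 1
  · refine lintegral_congr fun ξ => ?_
    simp only [walkW]
    by_cases hy : x + ξ ∈ Set.Ici (0 : ℝ)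
    · rw [Set.indicator_of_mem hy, Set.indicator_of_mem hy]; rfl
    · rw [Set.indicator_of_notMem hy, Set.indicator_of_notMem hy, zero_mul]
  · refine lintegral_congr fun y => ?_
    by_cases hy : y ∈ Set.Ici (0 : ℝ)
    · rw [Set.indicator_of_mem hy, Set.indicator_of_mem hy]; rfl
    · rw [Set.indicator_of_notMem hy, Set.indicator_of_notMem hy, mul_zero]

lemma exitProb_add_wop_le {G : ℝ → ℝ≥0∞} (hG1 : ∀ x, G x ≤ 1) (x : ℝ) :
    exitProb x +
      wop (Kernel.const ℝ laplaceMeasure) (walkW G) (fun p => p.1 + p.2) 1 x ≤ 1 := by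
  have hm : MeasurableSet {ξ : ℝ | x + ξ < 0} := measurableSet_lt (by fun_prop) measurable_const
  rw [exitProb, ← lintegral_indicator_one hm, wop, Kernel.const_apply,
    ← lintegral_add_left (measurable_one.indicator hm)]
  refine (lintegral_mono (g := fun _ => 1) fun ξ => ?_).trans (by simp)
  simp only [walkW, Pi.one_apply, mul_one]
  by_cases hξ : x + ξ < 0
  · rw [Set.indicator_of_mem (show ξ ∈ {ξ | x + ξ < 0} from hξ),
      Set.indicator_of_notMem (by simpa using hξ)]; simp
  · rw [Set.indicator_of_notMem (show ξ ∉ {ξ | x + ξ < 0} from hξ),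
      Set.indicator_of_mem (by simpa using hξ), zero_add]
    exact hG1 _

lemma exitProb_antitone : Antitone exitProb := fun x y hxy =>
  measure_mono fun ξ (hξ : y + ξ < 0) => show x + ξ < 0 by linarith

lemma exists_riccati_walkV {g : ℝ → ℝ} (hg : IsSubunit g) :
    ∃ u : ℝ → ℝ, (∀ x, 0 ≤ x → HasDerivAt u (2 * u x - g x - u x ^ 2) x) ∧
      (∀ x, 0 ≤ x → 0 ≤ u x ∧ u x ≤ 1) ∧
      walkV (fun x => ENNReal.ofReal (g x)) 0 = ENNReal.ofReal (1 / (2 - u 0)) := by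
  obtain ⟨hgc, z, hz, hgz⟩ := hg
  set G : ℝ → ℝ≥0∞ := fun x => ENNReal.ofReal (g x) with hG
  have hGm : Measurable G := by fun_prop
  have hG1 : ∀ x, G x ≤ 1 := fun x => ENNReal.ofReal_le_one.2 ((hgz x).2.trans hz.le)
  have hVm : Measurable (walkV G) :=
    measurable_neumann (measurable_walkW hGm) (by fun_prop) measurable_exitProb
  have hV1 : ∀ x, walkV G x ≤ 1 := neumann_le_one (measurable_walkW hGm) (by fun_prop)
    measurable_exitProb (exitProb_add_wop_le hG1)
  have hVtop : ∀ x, walkV G x ≠ ⊤ := fun x => ((hV1 x).trans_lt ENNReal.one_lt_top).ne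
  obtain ⟨u, hu, hu01, hu0⟩ := exists_riccati (g := g) (v := fun x => (walkV G x).toReal) hgc
    (fun x => ⟨(hgz x).1, (hgz x).2.trans hz.le⟩) hVm.ennreal_toReal
    (fun x _ => ⟨ENNReal.toReal_nonneg, ENNReal.toReal_le_of_le_ofReal zero_le_one
      (by simpa using hV1 x)⟩) (fun x hx => by
      have h := neumann_eq (κ := Kernel.const ℝ laplaceMeasure) (measurable_walkW hGm)
        (measurable_fst.add measurable_snd) measurable_exitProb x
      change walkV G x = exitProb x + wop _ _ _ (walkV G) x at h
      have hne := hVtop x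
      rw [h] at hne
      rw [h, ENNReal.toReal_add (ENNReal.add_ne_top.1 hne).1 (ENNReal.add_ne_top.1 hne).2,
        exitProb_eq hx, ENNReal.toReal_ofReal (by positivity)]
      congr 1
      change (wop _ _ (fun p => p.1 + p.2) _ _).toReal = _
      rw [wop_walk hGm hVm, ← integral_const_mul, integral_eq_lintegral_of_nonneg_ae
        (Eventually.of_forall fun y => by have := (hgz y).1; positivity)
        (by
          have hv := hVm.ennreal_toReal
          exact Measurable.aestronglyMeasurable (by fun_prop))]
      congr 1
      refine lintegral_congr fun y => ?_
      rw [← mul_assoc (1 / 2 : ℝ), ENNReal.ofReal_mul (p := 1 / 2 * Real.exp (-|y - x|))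
        (by positivity), ENNReal.ofReal_mul (hgz y).1, ENNReal.ofReal_toReal (hVtop y)])
  refine ⟨u, hu, hu01, ?_⟩
  rw [← hu0, ENNReal.ofReal_toReal (hVtop 0)]

lemma integral_exp_neg_abs_mul_linear {x t : ℝ} (hx : 0 ≤ x) (hxt : x ≤ t) :
    ∫ y in (0 : ℝ)..t, 1 / 2 * Real.exp (-|y - x|) * ((1 + t - y) / (2 + t)) =
      (1 + t - x) / (2 + t) - 1 / 2 * Real.exp (-x) := by
  have hc : Continuous fun y => 1 / 2 * Real.exp (-|y - x|) * ((1 + t - y) / (2 + t)) := by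
    fun_prop
  have ht : 2 + t ≠ 0 := by linarith
  rw [← intervalIntegral.integral_add_adjacent_intervals (hc.intervalIntegrable 0 x)
    (hc.intervalIntegrable x t)]
  have h1 : ∫ y in (0 : ℝ)..x, 1 / 2 * Real.exp (-|y - x|) * ((1 + t - y) / (2 + t)) =
      1 / 2 * Real.exp (x - x) * ((2 + t - x) / (2 + t)) -
        1 / 2 * Real.exp (0 - x) * ((2 + t - 0) / (2 + t)) := by
    refine intervalIntegral.integral_eq_sub_of_hasDerivAt
      (f := fun y => 1 / 2 * Real.exp (y - x) * ((2 + t - y) / (2 + t))) (fun y hy => ?_)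
      (hc.intervalIntegrable 0 x)
    rw [Set.uIcc_of_le hx] at hy
    have h := ((((hasDerivAt_id y).sub_const x).exp).const_mul (1 / 2)).mul
      ((((hasDerivAt_id y).const_sub (2 + t))).div_const (2 + t))
    refine h.congr_deriv ?_
    rw [abs_of_nonpos (by linarith [hy.2]), neg_neg]
    simp only [id]
    ring
  have h2 : ∫ y in x..t, 1 / 2 * Real.exp (-|y - x|) * ((1 + t - y) / (2 + t)) =
      1 / 2 * Real.exp (x - t) * ((t - t) / (2 + t)) * (-1) -
        1 / 2 * Real.exp (x - x) * ((t - x) / (2 + t)) * (-1) := by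
    refine intervalIntegral.integral_eq_sub_of_hasDerivAt
      (f := fun y => 1 / 2 * Real.exp (x - y) * ((t - y) / (2 + t)) * (-1)) (fun y hy => ?_)
      (hc.intervalIntegrable x t)
    rw [Set.uIcc_of_le hxt] at hy
    have h := (((((hasDerivAt_id y).const_sub x).exp).const_mul (1 / 2)).mul
      ((((hasDerivAt_id y).const_sub t)).div_const (2 + t))).mul_const (-1)
    refine h.congr_deriv ?_
    rw [abs_of_nonneg (by linarith [hy.1]), neg_sub]
    simp only [id]
    ring
  rw [h1, h2]
  simp only [sub_self, Real.exp_zero, zero_sub]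
  field_simp
  ring

lemma walkV_indicator_Iic {t : ℝ} (ht : 0 < t) :
    walkV ((Set.Iic t).indicator 1) 0 = ENNReal.ofReal ((1 + t) / (2 + t)) := by
  set G : ℝ → ℝ≥0∞ := (Set.Iic t).indicator 1 with hG
  have hGm : Measurable G := measurable_one.indicator measurableSet_Iic
  have hG1 : ∀ x, G x ≤ 1 := fun x => Set.indicator_apply_le' (fun _ => le_rfl) fun _ => zero_le_one
  have hvm : Measurable fun x => ENNReal.ofReal ((1 + t - x) / (2 + t)) := by fun_prop
  have hmem : (0 : ℝ) ∈ Set.Icc 0 t := ⟨le_rfl, ht.le⟩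
  have hfin : ∀ x, exitProb x ≠ ⊤ := fun x => measure_ne_top _ _
  have h := neumann_eq_of_contraction (κ := Kernel.const ℝ laplaceMeasure) (W := walkW G)
    (T := fun p => p.1 + p.2) (S := Set.Icc 0 t) (c := 1 - exitProb t) (measurable_walkW hGm)
    (by fun_prop) measurable_exitProb hvm ?_ ?_ ?_ ?_ ?_ hmem
  · rw [walkV, h, sub_zero]
  · intro x _
    refine Eventually.of_forall fun ξ hξ => ?_
    have h0 : x + ξ ∈ Set.Ici (0 : ℝ) := Set.mem_of_indicator_ne_zero hξ
    rw [walkW, Set.indicator_of_mem h0] at hξ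
    exact ⟨h0, Set.mem_of_indicator_ne_zero (s := Set.Iic t) hξ⟩
  · refine ENNReal.sub_lt_self ENNReal.one_ne_top one_ne_zero ?_
    rw [exitProb_eq ht.le]
    have := Real.exp_pos (-t)
    simpa using this
  · intro x hx
    exact ENNReal.le_sub_of_add_le_left (hfin t)
      ((add_le_add_left (exitProb_antitone hx.2) _).trans (exitProb_add_wop_le hG1 x))
  · intro x hx
    rw [ENNReal.ofReal_le_one, div_le_one (by linarith)]
    linarith [hx.1]
  · intro x hx
    rw [wop_walk hGm hvm, exitProb_eq hx.1]
    have h1 : ∫⁻ y in Set.Ici 0, ENNReal.ofReal (1 / 2 * Real.exp (-|y - x|)) *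
        (G y * ENNReal.ofReal ((1 + t - y) / (2 + t))) =
        ∫⁻ y in Set.Icc 0 t,
          ENNReal.ofReal (1 / 2 * Real.exp (-|y - x|) * ((1 + t - y) / (2 + t))) := by
      rw [← lintegral_indicator measurableSet_Ici, ← lintegral_indicator measurableSet_Icc]
      refine lintegral_congr fun y => ?_
      by_cases h0 : 0 ≤ y
      · rw [Set.indicator_of_mem (show y ∈ Set.Ici 0 from h0)]
        by_cases h1 : y ≤ t
        · rw [hG, Set.indicator_of_mem (show y ∈ Set.Iic t from h1),
            Set.indicator_of_mem (show y ∈ Set.Icc 0 t from ⟨h0, h1⟩),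
            ENNReal.ofReal_mul (p := 1 / 2 * Real.exp (-|y - x|)) (by positivity), Pi.one_apply,
            one_mul]
        · rw [hG, Set.indicator_of_notMem (show y ∉ Set.Iic t from h1),
            Set.indicator_of_notMem (fun h => h1 h.2), zero_mul, mul_zero]
      · rw [Set.indicator_of_notMem (show y ∉ Set.Ici 0 from h0),
          Set.indicator_of_notMem (fun h => h0 h.1)]
    have hc : Continuous fun y => 1 / 2 * Real.exp (-|y - x|) * ((1 + t - y) / (2 + t)) := by
      fun_prop
    rw [h1, ← ofReal_integral_eq_lintegral_ofReal (hc.integrableOn_Icc)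
      ((ae_restrict_mem measurableSet_Icc).mono fun y hy => ?_), integral_Icc_eq_integral_Ioc,
      ← intervalIntegral.integral_of_le ht.le, integral_exp_neg_abs_mul_linear hx.1 hx.2,
      ← ENNReal.ofReal_add (by positivity)]
    · congr 1; ring
    · rw [← integral_exp_neg_abs_mul_linear hx.1 hx.2]
      refine intervalIntegral.integral_nonneg ht.le fun y hy => ?_
      have : 0 ≤ (1 + t - y) / (2 + t) := div_nonneg (by linarith [hy.2]) (by linarith)
      positivity
    · have : 0 ≤ (1 + t - y) / (2 + t) := div_nonneg (by linarith [hy.2]) (by linarith)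
      change 0 ≤ _
      positivity

lemma prodAlong_indicator_Iic (x : ℕ → ℝ) (t : ℝ) :
    prodAlong ((Set.Iic t).indicator (1 : ℝ → ℝ≥0∞)) (walkOrderStats x) =
      {x | maxOrderStat x ≤ t}.indicator 1 x := by
  by_cases h : maxOrderStat x ≤ t
  · rw [Set.indicator_of_mem (show x ∈ {x | maxOrderStat x ≤ t} from h)]
    exact Finset.prod_eq_one fun i _ => Set.indicator_of_mem
      (s := Set.Iic t) ((monotone_walkOrderStats x (Fin.le_last i)).trans h) _
  · rw [Set.indicator_of_notMem (show x ∉ {x | maxOrderStat x ≤ t} from h)]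
    exact Finset.prod_eq_zero (Finset.mem_univ (Fin.last _)) (Set.indicator_of_notMem
      (s := Set.Iic t) h _)

lemma measure_maxOrderStat_le {t : ℝ} (ht : 0 < t) :
    incrementLaw ({x | ∃ k, walk x k < 0} ∩ {x | maxOrderStat x ≤ t}) =
      ENNReal.ofReal ((1 + t) / (2 + t)) := by
  classical
  have hG : Measurable ((Set.Iic t).indicator (1 : ℝ → ℝ≥0∞)) :=
    measurable_one.indicator measurableSet_Iic
  have h := lintegral_prodAlong_walk hG
  rw [walkV_indicator_Iic ht, Set.indicator_of_mem (show (0 : ℝ) ∈ Set.Iic t from ht.le),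
    Pi.one_apply, one_mul] at h
  rw [← h, ← lintegral_indicator_one (measurableSet_exists_walk_neg.inter
    (measurableSet_le measurable_maxOrderStat measurable_const))]
  refine lintegral_congr fun x => ?_
  rw [Set.inter_indicator_one, Pi.mul_apply, prodAlong_indicator_Iic]
  by_cases hx : ∃ k, walk x k < 0
  · rw [if_pos hx, Set.indicator_of_mem (show x ∈ {x | ∃ k, walk x k < 0} from hx), Pi.one_apply,
      one_mul]
  · rw [if_neg hx, Set.indicator_of_notMem (show x ∉ {x | ∃ k, walk x k < 0} from hx), zero_mul]

/-- The walk gets negative almost surely. -/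
theorem ae_exists_walk_neg : ∀ᵐ x ∂incrementLaw, ∃ k, walk x k < 0 := by
  have hlim : Tendsto (fun t : ℝ => ENNReal.ofReal ((1 + t) / (2 + t))) atTop (𝓝 1) := by
    rw [← ENNReal.ofReal_one]
    refine ENNReal.tendsto_ofReal ?_
    have h1 : Tendsto (fun t : ℝ => 1 - (2 + t)⁻¹) atTop (𝓝 (1 - 0)) :=
      tendsto_const_nhds.sub (tendsto_inv_atTop_zero.comp
        (tendsto_atTop_add_const_left _ _ tendsto_id))
    rw [sub_zero] at h1
    refine h1.congr' ((eventually_gt_atTop 0).mono fun t ht => ?_)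
    field_simp
    ring
  have hle : 1 ≤ incrementLaw {x : ℕ → ℝ | ∃ k, walk x k < 0} := by
    refine le_of_tendsto hlim ((eventually_gt_atTop 0).mono fun t ht => ?_)
    rw [← measure_maxOrderStat_le ht]
    exact measure_mono Set.inter_subset_left
  exact (prob_compl_eq_zero_iff measurableSet_exists_walk_neg).2 (le_antisymm prob_le_one hle)

theorem measure_lt_maxOrderStat {t : ℝ} (ht : 0 < t) :
    incrementLaw {x | t < maxOrderStat x} = ENNReal.ofReal (1 / (2 + t)) := by
  have h1 : incrementLaw {x | maxOrderStat x ≤ t} = ENNReal.ofReal ((1 + t) / (2 + t)) := by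
    rw [← measure_maxOrderStat_le ht]
    exact measure_congr (ae_exists_walk_neg.mono fun x hx => by
      simp only [eq_iff_iff]
      exact ⟨fun h => ⟨hx, h⟩, fun h => h.2⟩)
  have h2 : {x : ℕ → ℝ | t < maxOrderStat x} = {x | maxOrderStat x ≤ t}ᶜ := by
    ext x; simp
  rw [h2, prob_compl_eq_one_sub (measurableSet_le measurable_maxOrderStat measurable_const), h1,
    ← ENNReal.ofReal_one, ← ENNReal.ofReal_sub _ (by positivity)]
  congr 1
  field_simp
  ring

/-- Joint law of holding time and next state for the critical binary process. -/
noncomputable abbrev criticalKernel : Kernel ℕ (ℝ≥0∞ × ℕ) :=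
  holdJumpKernel (fun j => (j : ℝ≥0)) (fun j => (j : ℝ≥0))

lemma criticalKernel_zero : criticalKernel 0 = Measure.dirac (⊤, 0) := by
  change holdJumpLaw _ _ 0 = _
  simp [holdJumpLaw]

lemma criticalKernel_of_ne_zero {j : ℕ} (hj : j ≠ 0) : criticalKernel j =
    ((expMeasure (2 * j)).map ENNReal.ofReal).prod
      ((2⁻¹ : ℝ≥0) • Measure.dirac (j + 1) + (2⁻¹ : ℝ≥0) • Measure.dirac (j - 1)) := by
  change holdJumpLaw _ _ j = _
  have hj' : (j : ℝ≥0) ≠ 0 := Nat.cast_ne_zero.2 hj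
  have h1 : (j : ℝ≥0) / (j + j) = 2⁻¹ := by field_simp; norm_num
  have h2 : (j : ℝ) + j = 2 * j := by ring
  simp [holdJumpLaw, hj, h1, h2]

lemma lintegral_criticalKernel {j : ℕ} (hj : j ≠ 0) {F : ℝ≥0∞ × ℕ → ℝ≥0∞} (hF : Measurable F) :
    ∫⁻ q, F q ∂criticalKernel j =
      ∫⁻ r in Set.Ioi 0, ENNReal.ofReal (2 * j * Real.exp (-(2 * j * r))) *
        (2⁻¹ * F (ENNReal.ofReal r, j + 1) + 2⁻¹ * F (ENNReal.ofReal r, j - 1)) := by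
  have hj' : (0 : ℝ) < 2 * j := by positivity
  have := isProbabilityMeasure_expMeasure hj'
  have hpdf : Measurable (gammaPDF 1 (2 * j)) := (measurable_gammaPDFReal _ _).ennreal_ofReal
  rw [criticalKernel_of_ne_zero hj, lintegral_prod _ hF.aemeasurable,
    lintegral_map (by fun_prop) (by fun_prop), expMeasure, gammaMeasure,
    lintegral_withDensity_eq_lintegral_mul _ hpdf (by fun_prop),
    setLIntegral_congr Ioi_ae_eq_Ici, ← lintegral_indicator measurableSet_Ici]
  refine lintegral_congr fun r => ?_
  rw [Pi.mul_apply, show gammaPDF 1 (2 * j) r = exponentialPDF (2 * j) r from rfl]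
  by_cases hr : 0 ≤ r
  · rw [Set.indicator_of_mem (show r ∈ Set.Ici 0 from hr), exponentialPDF_of_nonneg hr,
      lintegral_add_measure, lintegral_smul_measure, lintegral_smul_measure,
      lintegral_dirac' _ (by fun_prop), lintegral_dirac' _ (by fun_prop)]
    simp [ENNReal.smul_def]
  · rw [Set.indicator_of_notMem (show r ∉ Set.Ici 0 from hr), exponentialPDF_of_neg (not_le.1 hr),
      zero_mul]

/-- The transition kernel of the pairs (jump time, state). -/
noncomputable abbrev chainKernel : Kernel (ℝ≥0∞ × ℕ) (ℝ≥0∞ × ℕ) :=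
  criticalKernel.comap Prod.snd measurable_snd

/-- The weight of a jump of the chain: `G` evaluated at the death time if the jump is a death. -/
noncomputable def chainW (G : ℝ≥0∞ → ℝ≥0∞) (p : (ℝ≥0∞ × ℕ) × ℝ≥0∞ × ℕ) : ℝ≥0∞ :=
  if p.1.2 = 0 then 0 else if p.2.2 < p.1.2 then G (p.1.1 + p.2.1) else 1

/-- Time and state after a jump. -/
def chainT (p : (ℝ≥0∞ × ℕ) × ℝ≥0∞ × ℕ) : ℝ≥0∞ × ℕ := (p.1.1 + p.2.1, p.2.2)

/-- The indicator of extinction. -/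
noncomputable def chainEnd (p : ℝ≥0∞ × ℕ) : ℝ≥0∞ := if p.2 = 0 then 1 else 0

lemma measurable_chainW {G : ℝ≥0∞ → ℝ≥0∞} (hG : Measurable G) : Measurable (chainW G) := by
  unfold chainW
  refine Measurable.ite ?_ measurable_const (Measurable.ite ?_ (by fun_prop) measurable_const)
  · exact (measurable_fst.snd : Measurable fun p : (ℝ≥0∞ × ℕ) × ℝ≥0∞ × ℕ => p.1.2)
      (measurableSet_singleton 0)
  · exact measurableSet_lt (by fun_prop) (by fun_prop)

@[fun_prop]
lemma measurable_chainT : Measurable chainT := by unfold chainT; fun_prop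

lemma measurable_chainEnd : Measurable chainEnd :=
  (measurable_from_top (f := fun n : ℕ => if n = 0 then (1 : ℝ≥0∞) else 0)).comp measurable_snd

lemma lintegral_riccati {g u : ℝ → ℝ} {s : ℝ} (hs : 0 ≤ s) (hg : ∀ x, 0 ≤ x → 0 ≤ g x)
    (hu : ∀ x, 0 ≤ x → HasDerivAt u (2 * u x - g x - u x ^ 2) x)
    (hu01 : ∀ x, 0 ≤ x → 0 ≤ u x ∧ u x ≤ 1) {j : ℕ} (hj : j ≠ 0) :
    ∫⁻ r in Set.Ioi 0, ENNReal.ofReal (j * Real.exp (-(2 * j * r)) *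
      (u (s + r) ^ (j + 1) + g (s + r) * u (s + r) ^ (j - 1))) = ENNReal.ofReal (u s ^ j) := by
  have hjp : (0 : ℝ) < j := by positivity
  set k : ℝ → ℝ := fun r => Real.exp (-(2 * j * r)) * u (s + r) ^ j with hk
  set k' : ℝ → ℝ := fun r => -(j * Real.exp (-(2 * j * r)) *
      (u (s + r) ^ (j + 1) + g (s + r) * u (s + r) ^ (j - 1))) with hk'
  have hderiv : ∀ r ∈ Set.Ici (0 : ℝ), HasDerivAt k (k' r) r := by
    intro r hr
    have h1 : HasDerivAt (fun r : ℝ => Real.exp (-(2 * j * r)))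
        (Real.exp (-(2 * j * r)) * (-(2 * j * 1))) r :=
      (((hasDerivAt_id r).const_mul (2 * (j : ℝ))).neg).exp
    have h2 : HasDerivAt (fun r => u (s + r)) (2 * u (s + r) - g (s + r) - u (s + r) ^ 2) r :=
      (hu (s + r) (add_nonneg hs hr)).comp_const_add s r
    refine (h1.mul (h2.pow j)).congr_deriv ?_
    obtain ⟨m, rfl⟩ := Nat.exists_eq_succ_of_ne_zero hj
    simp only [hk', Nat.succ_eq_add_one, Nat.add_sub_cancel, Pi.pow_apply]
    ring
  have hneg : ∀ r ∈ Set.Ioi (0 : ℝ), k' r ≤ 0 := by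
    intro r hr
    have h0 : 0 ≤ s + r := add_nonneg hs (le_of_lt hr)
    have h1 := (hu01 _ h0).1
    have h2 := hg _ h0
    simp only [hk', Left.neg_nonpos_iff]
    positivity
  have hlim : Tendsto k atTop (𝓝 0) := by
    have h1 : Tendsto (fun r : ℝ => Real.exp (-(2 * j * r))) atTop (𝓝 0) :=
      Real.tendsto_exp_neg_atTop_nhds_zero.comp
        (tendsto_id.const_mul_atTop (by positivity : (0 : ℝ) < 2 * j))
    refine tendsto_of_tendsto_of_tendsto_of_le_of_le' tendsto_const_nhds h1
      ((eventually_ge_atTop 0).mono fun r hr => ?_) ((eventually_ge_atTop 0).mono fun r hr => ?_)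
    · have := (hu01 _ (add_nonneg hs hr)).1
      positivity
    · obtain ⟨h2, h3⟩ := hu01 _ (add_nonneg hs hr)
      exact mul_le_of_le_one_right (Real.exp_pos _).le (pow_le_one₀ h2 h3)
  have hint := integral_Ioi_of_hasDerivAt_of_nonpos' hderiv hneg hlim
  have hion := integrableOn_Ioi_deriv_of_nonpos' hderiv hneg hlim
  have h0 : k 0 = u s ^ j := by simp [hk]
  rw [zero_sub, h0] at hint
  have : ∀ r, j * Real.exp (-(2 * j * r)) *
      (u (s + r) ^ (j + 1) + g (s + r) * u (s + r) ^ (j - 1)) = -k' r := fun r => by simp [hk']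
  simp_rw [this]
  rw [← ofReal_integral_eq_lintegral_ofReal (f := fun r => -k' r) hion.neg
    ((ae_restrict_mem measurableSet_Ioi).mono fun r hr => neg_nonneg.2 (hneg r hr)),
    integral_neg, hint, neg_neg]

/-- The branching property: starting from `j` individuals at time `s`, the multiplicative
functional of the death times is the `j`-th power of a solution of a Riccati equation. -/
lemma neumann_chain {g u : ℝ → ℝ} (hg : IsSubunit g)
    (hu : ∀ x, 0 ≤ x → HasDerivAt u (2 * u x - g x - u x ^ 2) x)
    (hu01 : ∀ x, 0 ≤ x → 0 ≤ u x ∧ u x ≤ 1) (j : ℕ) :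
    neumann chainKernel (chainW fun t => ENNReal.ofReal (g t.toReal)) chainT chainEnd (0, j) =
      ENNReal.ofReal (u 0) ^ j := by
  obtain ⟨hgc, z, hz, hgz⟩ := hg
  have hz0 : 0 ≤ z := (hgz 0).1.trans (hgz 0).2
  set G : ℝ≥0∞ → ℝ≥0∞ := fun t => ENNReal.ofReal (g t.toReal) with hG
  have hGm : Measurable G := by fun_prop
  have huc : Continuous fun x => u (max x 0) := by
    have h1 : ContinuousOn u (Set.Ici 0) := fun x hx => (hu x hx).continuousAt.continuousWithinAt
    exact h1.comp_continuous (by fun_prop) fun x => Set.mem_Ici.2 (le_max_right _ _)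
  set U : ℝ → ℝ := (Set.Ici 0).indicator u with hU
  have hUm : Measurable U := by
    have : U = (Set.Ici 0).indicator fun x => u (max x 0) := by
      refine Set.indicator_congr fun x hx => ?_
      rw [max_eq_left (show 0 ≤ x from hx)]
    rw [this]
    exact huc.measurable.indicator measurableSet_Ici
  have hUu : ∀ x, 0 ≤ x → U x = u x := fun x hx =>
    Set.indicator_of_mem (show x ∈ Set.Ici 0 from hx) _
  set v : ℝ≥0∞ × ℕ → ℝ≥0∞ := fun p => ENNReal.ofReal (U p.1.toReal) ^ p.2 with hv
  have hvm : Measurable v := by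
    have : Measurable fun p : ℝ≥0∞ × ℕ => ENNReal.ofReal (U p.1.toReal) := by fun_prop
    exact this.pow measurable_snd
  have hWm := measurable_chainW hGm
  have hW0 : ∀ s q, chainW G ((s, 0), q) = 0 := fun s q => by simp [chainW]
  have hop0 : ∀ f s, wop chainKernel (chainW G) chainT f (s, 0) = 0 := fun f s => by
    simp [wop, hW0]
  have hop : ∀ f, Measurable f → ∀ s j, j ≠ 0 →
      wop chainKernel (chainW G) chainT f (s, j) =
        ∫⁻ r in Set.Ioi 0, ENNReal.ofReal (2 * j * Real.exp (-(2 * j * r))) *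
          (2⁻¹ * f (s + ENNReal.ofReal r, j + 1) +
            2⁻¹ * (G (s + ENNReal.ofReal r) * f (s + ENNReal.ofReal r, j - 1))) := by
    intro f hf s j hj
    have h := lintegral_criticalKernel hj (F := fun q => chainW G ((s, j), q) *
      f (chainT ((s, j), q))) (by fun_prop)
    have hlt : j - 1 < j := by omega
    simpa [wop, chainW, chainT, hj, hlt] using h
  have hmem : ((0, j) : ℝ≥0∞ × ℕ) ∈ {p : ℝ≥0∞ × ℕ | p.1 ≠ ⊤} := ENNReal.zero_ne_top
  have h := neumann_eq_of_contraction (κ := chainKernel) (W := chainW G) (T := chainT)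
    (b := chainEnd) (v := v) (S := {p | p.1 ≠ ⊤}) (c := ENNReal.ofReal ((1 + z) / 2)) hWm
    measurable_chainT measurable_chainEnd hvm ?_ ?_ ?_ ?_ ?_ hmem
  · rw [h, hv]
    simp [hUu]
  · rintro ⟨s, j⟩ hs
    by_cases hj : j = 0
    · exact Eventually.of_forall fun q hq => (hq (by rw [hj, hW0])).elim
    · have hbad : MeasurableSet {q : ℝ≥0∞ × ℕ | q.1 = ⊤} :=
        measurable_fst (measurableSet_singleton _)
      have h0 : ∀ᵐ q ∂criticalKernel j, q.1 ≠ ⊤ := by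
        rw [ae_iff]
        simp only [not_not]
        rw [← lintegral_indicator_one hbad, lintegral_criticalKernel hj
          (measurable_one.indicator hbad)]
        simp
      exact h0.mono fun q hq _ => ENNReal.add_ne_top.2 ⟨hs, hq⟩
  · rw [ENNReal.ofReal_lt_one]; linarith
  · rintro ⟨s, j⟩ hs
    by_cases hj : j = 0
    · rw [hj, hop0]; exact zero_le
    · rw [hop 1 measurable_one s j hj]
      have hmass := lintegral_criticalKernel hj (F := 1) measurable_one
      simp only [Pi.one_apply, lintegral_one, measure_univ, mul_one] at hmass ⊢
      rw [ENNReal.inv_two_add_inv_two] at hmass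
      simp only [mul_one] at hmass
      have hle : ∀ r, 2⁻¹ + 2⁻¹ * G (s + ENNReal.ofReal r) ≤ ENNReal.ofReal ((1 + z) / 2) := by
        intro r
        have h1 : G (s + ENNReal.ofReal r) ≤ ENNReal.ofReal z := ENNReal.ofReal_le_ofReal (hgz _).2
        have h2 : ENNReal.ofReal ((1 + z) / 2) = 2⁻¹ + 2⁻¹ * ENNReal.ofReal z := by
          rw [show (1 + z) / 2 = 2⁻¹ + 2⁻¹ * z by ring, ENNReal.ofReal_add (by norm_num)
            (by positivity), ENNReal.ofReal_mul (by norm_num)]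
          simp
        rw [h2]
        gcongr
      refine (lintegral_mono fun r => mul_le_mul_right (hle r) _).trans ?_
      rw [lintegral_mul_const _ (by fun_prop), ← hmass, one_mul]
  · rintro ⟨s, j⟩ hs
    refine pow_le_one₀ zero_le (ENNReal.ofReal_le_one.2 ?_)
    rw [hUu _ ENNReal.toReal_nonneg]
    exact (hu01 _ ENNReal.toReal_nonneg).2
  · rintro ⟨s, j⟩ hs
    by_cases hj : j = 0
    · subst hj
      rw [hop0]
      simp [hv, chainEnd]
    · rw [hop v hvm s j hj]
      have hs0 := ENNReal.toReal_nonneg (a := s)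
      simp only [hv, chainEnd, hj, if_false, zero_add]
      rw [hUu _ hs0, ← ENNReal.ofReal_pow (hu01 _ hs0).1,
        ← lintegral_riccati hs0 (fun x _ => (hgz x).1) hu hu01 hj]
      · refine setLIntegral_congr_fun measurableSet_Ioi fun r hr => ?_
        have hr0 : (0 : ℝ) ≤ r := le_of_lt hr
        have hsr : 0 ≤ s.toReal + r := add_nonneg hs0 hr0
        have h1 := (hu01 _ hsr).1
        have h2 := (hgz (s.toReal + r)).1
        simp only [hG]
        rw [ENNReal.toReal_add hs ENNReal.ofReal_ne_top, ENNReal.toReal_ofReal hr0, hUu _ hsr,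
          ← ENNReal.ofReal_pow h1, ← ENNReal.ofReal_pow h1, ← ENNReal.ofReal_mul h2,
          show (2⁻¹ : ℝ≥0∞) = ENNReal.ofReal 2⁻¹ by simp, ← ENNReal.ofReal_mul (by norm_num),
          ← ENNReal.ofReal_mul (by norm_num), ← ENNReal.ofReal_add (by positivity) (by positivity),
          ← ENNReal.ofReal_mul (by positivity)]
        congr 1
        ring

/-- Sequences of holding times and of states. -/
abbrev ChainSeq : Type := (ℕ → ℝ≥0∞) × (ℕ → ℕ)

/-- The sequences stopped after `n` holding times and `n + 1` states. -/
def truncSeq (n : ℕ) (w : ChainSeq) : ChainSeq :=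
  (fun k => if k < n then w.1 k else 0, fun k => if k < n + 1 then w.2 k else 0)

/-- The law of the holding times and states of a critical binary process. -/
def IsChainLaw (ρ : Measure ChainSeq) : Prop :=
  ∀ (n : ℕ) (F : ChainSeq × ℝ≥0∞ × ℕ → ℝ≥0∞), Measurable F →
    (∀ w q, F (w, q) = F (truncSeq n w, q)) →
    ∫⁻ w, F (w, w.1 n, w.2 (n + 1)) ∂ρ = ∫⁻ w, ∫⁻ q, F (w, q) ∂criticalKernel (w.2 n) ∂ρ

section

variable {Ω : Type*} [MeasurableSpace Ω] {Q : Measure Ω}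
  {Y : ℕ → Ω → ℕ} {H : ℕ → Ω → ℝ≥0∞}

lemma aemeasurable_chainSeq
    (h : ∀ n : ℕ, HasCondDistrib (fun ω => (H n ω, Y (n + 1) ω))
      (fun ω => ((fun k : Fin n => H k ω), (fun k : Fin (n + 1) => Y k ω)))
      (criticalKernel.comap
        (fun p : (Fin n → ℝ≥0∞) × (Fin (n + 1) → ℕ) => p.2 (Fin.last n)) (by fun_prop)) Q) :
    AEMeasurable (fun ω => ((fun k => H k ω, fun k => Y k ω) : ChainSeq)) Q := by
  refine AEMeasurable.prodMk (aemeasurable_pi_iff.2 fun n => (h n).aemeasurable_snd.fst)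
    (aemeasurable_pi_iff.2 fun n => ?_)
  cases n with
  | zero =>
    have := (h 0).aemeasurable_fst.snd
    exact aemeasurable_pi_iff.1 this 0
  | succ n => exact (h n).aemeasurable_snd.snd

lemma isChainLaw_map [IsFiniteMeasure Q]
    (h : ∀ n : ℕ, HasCondDistrib (fun ω => (H n ω, Y (n + 1) ω))
      (fun ω => ((fun k : Fin n => H k ω), (fun k : Fin (n + 1) => Y k ω)))
      (criticalKernel.comap
        (fun p : (Fin n → ℝ≥0∞) × (Fin (n + 1) → ℕ) => p.2 (Fin.last n)) (by fun_prop)) Q) :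
    IsChainLaw (Q.map fun ω => (fun k => H k ω, fun k => Y k ω)) := by
  intro n F hF hFn
  have hm := aemeasurable_chainSeq h
  let e : (Fin n → ℝ≥0∞) × (Fin (n + 1) → ℕ) → ChainSeq := fun p =>
    (fun k => if hk : k < n then p.1 ⟨k, hk⟩ else 0,
      fun k => if hk : k < n + 1 then p.2 ⟨k, hk⟩ else 0)
  have he : Measurable e := by
    refine Measurable.prodMk (measurable_pi_lambda _ fun k => ?_)
      (measurable_pi_lambda _ fun k => ?_)
    · by_cases hk : k < n
      · simp only [hk, dif_pos]; fun_prop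
      · simp only [hk, dif_neg, not_false_eq_true]; fun_prop
    · by_cases hk : k < n + 1
      · simp only [hk, dif_pos]; fun_prop
      · simp only [hk, dif_neg, not_false_eq_true]; fun_prop
  have hFe : ∀ ω q, F (((fun k => H k ω, fun k => Y k ω) : ChainSeq), q) =
      F (e ((fun k : Fin n => H k ω), (fun k : Fin (n + 1) => Y k ω)), q) := by
    intro ω q
    rw [hFn]
    congr 2
  have hinner : Measurable fun w : ChainSeq => ∫⁻ q, F (w, q) ∂criticalKernel (w.2 n) :=
    Measurable.lintegral_kernel_prod_right' (κ := criticalKernel.comap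
      (fun w : ChainSeq => w.2 n) (by fun_prop)) hF
  rw [lintegral_map' (by fun_prop) hm, lintegral_map' hinner.aemeasurable hm]
  simp only [hFe]
  have hFe' : Measurable fun p : ((Fin n → ℝ≥0∞) × (Fin (n + 1) → ℕ)) × ℝ≥0∞ × ℕ =>
      F (e p.1, p.2) := by fun_prop
  have h1 := lintegral_map' (hFe'.aemeasurable) (h n).aemeasurable
  rw [(h n).map_eq, Measure.lintegral_compProd hFe', lintegral_map'
    (Measurable.lintegral_kernel_prod_right' hFe').aemeasurable (h n).aemeasurable_fst] at h1
  exact h1.symm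

end

/-- The `n`-th jump time. -/
noncomputable def jumpTime (w : ChainSeq) (n : ℕ) : ℝ≥0∞ := ∑ k ∈ Finset.range n, w.1 k

@[fun_prop]
lemma measurable_jumpTime (n : ℕ) : Measurable fun w => jumpTime w n := by
  unfold jumpTime; fun_prop

lemma jumpTime_succ (w : ChainSeq) (n : ℕ) : jumpTime w (n + 1) = jumpTime w n + w.1 n :=
  Finset.sum_range_succ _ _

/-- The product of the weights of the first `n` jumps. -/
noncomputable def chainWeight (G : ℝ≥0∞ → ℝ≥0∞) (n : ℕ) (w : ChainSeq) : ℝ≥0∞ :=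
  ∏ k ∈ Finset.range n, chainW G ((jumpTime w k, w.2 k), (w.1 k, w.2 (k + 1)))

lemma measurable_chainWeight {G : ℝ≥0∞ → ℝ≥0∞} (hG : Measurable G) (n : ℕ) :
    Measurable (chainWeight G n) := by
  have := measurable_chainW hG
  unfold chainWeight
  fun_prop

/-- The product of the values of `G` at the death times on extinction, and `0` otherwise. -/
noncomputable def chainFunctional (G : ℝ≥0∞ → ℝ≥0∞) (w : ChainSeq) : ℝ≥0∞ :=
  ∑' n, chainWeight G n w * chainEnd (jumpTime w n, w.2 n)

section

variable {ρ : Measure ChainSeq}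

lemma lintegral_chainWeight (hρ : IsChainLaw ρ) {G : ℝ≥0∞ → ℝ≥0∞} (hG : Measurable G) (n : ℕ) :
    ∀ {f : ℝ≥0∞ × ℕ → ℝ≥0∞}, Measurable f →
    ∫⁻ w, chainWeight G n w * f (jumpTime w n, w.2 n) ∂ρ =
      ∫⁻ w, (wop chainKernel (chainW G) chainT)^[n] f (0, w.2 0) ∂ρ := by
  have hW := measurable_chainW hG
  induction n with
  | zero => intro f _; simp [chainWeight, jumpTime]
  | succ n ih =>
    intro f hf
    rw [Function.iterate_succ_apply, ← ih (measurable_wop hW (by fun_prop) hf)]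
    have hwt := measurable_chainWeight hG n
    have h := hρ n (fun p => chainWeight G n p.1 *
      (chainW G ((jumpTime p.1 n, p.1.2 n), p.2) * f (chainT ((jumpTime p.1 n, p.1.2 n), p.2))))
      (by fun_prop) ?_
    · calc ∫⁻ w, chainWeight G (n + 1) w * f (jumpTime w (n + 1), w.2 (n + 1)) ∂ρ = _ := by
            refine lintegral_congr fun w => ?_
            rw [chainWeight, Finset.prod_range_succ, mul_assoc, jumpTime_succ]
            rfl
        _ = _ := h
        _ = _ := by
            refine lintegral_congr fun w => ?_
            dsimp only
            rw [lintegral_const_mul _ (by fun_prop)]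
            rfl
    · intro w q
      have h1 : ∀ k < n, (truncSeq n w).1 k = w.1 k := fun k hk => if_pos hk
      have h2 : ∀ k ≤ n, (truncSeq n w).2 k = w.2 k := fun k hk => if_pos (Nat.lt_succ_of_le hk)
      have h3 : ∀ k ≤ n, jumpTime (truncSeq n w) k = jumpTime w k := fun k hk =>
        Finset.sum_congr rfl fun i hi => h1 i ((Finset.mem_range.1 hi).trans_le hk)
      have h4 : chainWeight G n (truncSeq n w) = chainWeight G n w :=
        Finset.prod_congr rfl fun k hk => by
          have hk := Finset.mem_range.1 hk
          rw [h1 k hk, h2 k hk.le, h2 (k + 1) hk, h3 k hk.le]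
      simp only
      rw [h4, h3 n le_rfl, h2 n le_rfl]

lemma lintegral_chainFunctional (hρ : IsChainLaw ρ)
    (h0 : ∀ n, ρ {w | w.2 0 = n} = 2⁻¹ ^ (n + 1)) {g u : ℝ → ℝ} (hg : IsSubunit g)
    (hu : ∀ x, 0 ≤ x → HasDerivAt u (2 * u x - g x - u x ^ 2) x)
    (hu01 : ∀ x, 0 ≤ x → 0 ≤ u x ∧ u x ≤ 1) :
    ∫⁻ w, chainFunctional (fun t => ENNReal.ofReal (g t.toReal)) w ∂ρ =
      ENNReal.ofReal (1 / (2 - u 0)) := by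
  have hgm := hg.1.measurable
  have hG : Measurable fun t : ℝ≥0∞ => ENNReal.ofReal (g t.toReal) := by fun_prop
  have hW := measurable_chainW hG
  have hE := measurable_chainEnd
  obtain ⟨hu0, hu1⟩ := hu01 0 le_rfl
  simp only [chainFunctional]
  rw [lintegral_tsum fun n => by
    have := measurable_chainWeight hG n
    exact Measurable.aemeasurable (by fun_prop)]
  simp only [lintegral_chainWeight hρ hG _ hE]
  rw [← lintegral_tsum fun n => by
    have := measurable_wop_iterate (κ := chainKernel) hW measurable_chainT hE n
    exact Measurable.aemeasurable (by fun_prop)]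
  change ∫⁻ w, neumann chainKernel (chainW _) chainT chainEnd (0, w.2 0) ∂ρ = _
  simp only [neumann_chain hg hu hu01]
  have hm : Measurable fun w : ChainSeq => w.2 0 := by fun_prop
  rw [← lintegral_map (f := fun n : ℕ => ENNReal.ofReal (u 0) ^ n) measurable_from_top hm,
    lintegral_countable']
  have h1 : ∀ n : ℕ, ENNReal.ofReal (u 0) ^ n * ρ.map (fun w : ChainSeq => w.2 0) {n} =
      2⁻¹ * ENNReal.ofReal (u 0 / 2) ^ n := by
    intro n
    rw [Measure.map_apply hm (measurableSet_singleton n)]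
    change _ * ρ {w | w.2 0 = n} = _
    rw [h0, div_eq_mul_inv, ENNReal.ofReal_mul hu0, mul_pow,
      show ENNReal.ofReal 2⁻¹ = 2⁻¹ by simp]
    ring
  simp only [h1]
  rw [ENNReal.tsum_mul_left, ENNReal.tsum_geometric, ← ENNReal.ofReal_one,
    ← ENNReal.ofReal_sub _ (by positivity), ← ENNReal.ofReal_inv_of_pos (by linarith),
    show (2⁻¹ : ℝ≥0∞) = ENNReal.ofReal 2⁻¹ by simp, ← ENNReal.ofReal_mul (by norm_num)]
  congr 1
  have : 2 - u 0 ≠ 0 := by linarith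
  field_simp

lemma chainWeight_le_one {G : ℝ≥0∞ → ℝ≥0∞} (hG : ∀ t, G t ≤ 1) (n : ℕ) (w : ChainSeq) :
    chainWeight G n w ≤ 1 := by
  refine Finset.prod_le_one' fun k _ => ?_
  unfold chainW
  split_ifs
  exacts [zero_le_one, hG _, le_rfl]

lemma chainFunctional_of_forall_ne {G : ℝ≥0∞ → ℝ≥0∞} {w : ChainSeq} (h : ∀ n, w.2 n ≠ 0) :
    chainFunctional G w = 0 := by
  simp [chainFunctional, chainEnd, h]

lemma chainFunctional_eq {G : ℝ≥0∞ → ℝ≥0∞} {w : ChainSeq} {m : ℕ} (hm : w.2 m = 0)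
    (h : ∀ n < m, w.2 n ≠ 0) : chainFunctional G w = chainWeight G m w := by
  rw [chainFunctional, tsum_eq_single m]
  · simp [chainEnd, hm]
  · intro n hn
    rcases lt_or_gt_of_ne hn with hn | hn
    · simp [chainEnd, h n hn]
    · rw [chainWeight, Finset.prod_eq_zero (Finset.mem_range.2 hn) (by simp [chainW, hm]), zero_mul]

lemma chainFunctional_le_one {G : ℝ≥0∞ → ℝ≥0∞} (hG : ∀ t, G t ≤ 1) (w : ChainSeq) :
    chainFunctional G w ≤ 1 := by
  by_cases h : ∃ n, w.2 n = 0
  · classical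
    rw [chainFunctional_eq (Nat.find_spec h) fun n hn => Nat.find_min h hn]
    exact chainWeight_le_one hG _ _
  · push Not at h
    rw [chainFunctional_of_forall_ne h]
    exact zero_le_one

/-- The critical binary process becomes extinct almost surely. -/
theorem ae_exists_eq_zero [IsProbabilityMeasure ρ] (hρ : IsChainLaw ρ)
    (h0 : ∀ n, ρ {w | w.2 0 = n} = 2⁻¹ ^ (n + 1)) : ∀ᵐ w ∂ρ, ∃ n, w.2 n = 0 := by
  have hmeas : MeasurableSet {w : ChainSeq | ∃ n, w.2 n = 0} := by
    simp only [Set.ofPred_exists]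
    refine MeasurableSet.iUnion fun n => ?_
    have : Measurable fun w : ChainSeq => w.2 n := by fun_prop
    exact this (measurableSet_singleton 0)
  have hle : ∀ z ∈ Set.Ico (0 : ℝ) 1, ENNReal.ofReal (1 / (1 + √(1 - z))) ≤
      ρ {w : ChainSeq | ∃ n, w.2 n = 0} := by
    intro z hz
    have hs : √(1 - z) ^ 2 = 1 - z := Real.sq_sqrt (by linarith [hz.2])
    have hs0 := Real.sqrt_nonneg (1 - z)
    have hs1 : √(1 - z) ≤ 1 := Real.sqrt_le_one.2 (by linarith [hz.1])
    have h := lintegral_chainFunctional hρ h0 (g := fun _ => z) (u := fun _ => 1 - √(1 - z))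
      ⟨continuous_const, z, hz.2, fun _ => ⟨hz.1, le_rfl⟩⟩
      (fun x _ => (hasDerivAt_const x _).congr_deriv (by linear_combination hs))
      (fun x _ => ⟨by linarith, by linarith⟩)
    rw [show 2 - (1 - √(1 - z)) = 1 + √(1 - z) by ring] at h
    rw [← h, ← lintegral_indicator_one hmeas]
    refine lintegral_mono fun w => ?_
    by_cases hw : ∃ n, w.2 n = 0
    · rw [Set.indicator_of_mem (show w ∈ {w : ChainSeq | ∃ n, w.2 n = 0} from hw)]
      exact chainFunctional_le_one (fun t => ENNReal.ofReal_le_one.2 hz.2.le) w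
    · push Not at hw
      rw [chainFunctional_of_forall_ne hw]
      exact zero_le
  have hlim : Tendsto (fun z : ℝ => ENNReal.ofReal (1 / (1 + √(1 - z)))) (𝓝[<] 1) (𝓝 1) := by
    have h1 : ContinuousAt (fun z : ℝ => 1 / (1 + √(1 - z))) 1 := by
      refine ContinuousAt.div (by fun_prop) (by fun_prop) ?_
      simp
    have h2 := ENNReal.tendsto_ofReal h1.tendsto
    simp only [sub_self, Real.sqrt_zero, add_zero, div_one, ENNReal.ofReal_one] at h2
    exact h2.mono_left nhdsWithin_le_nhds
  have h1 : 1 ≤ ρ {w : ChainSeq | ∃ n, w.2 n = 0} := by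
    refine le_of_tendsto hlim ?_
    filter_upwards [Ioo_mem_nhdsLT (zero_lt_one (α := ℝ))] with z hz
    exact hle z ⟨hz.1.le, hz.2⟩
  exact (prob_compl_eq_zero_iff hmeas).2 (le_antisymm prob_le_one h1)

/-- Possible holding times and next states of the critical binary process in the state `j`. -/
def IsJump (j : ℕ) (q : ℝ≥0∞ × ℕ) : Prop :=
  (j ≠ 0 → 0 < q.1 ∧ q.1 ≠ ⊤ ∧ (q.2 = j + 1 ∨ q.2 + 1 = j)) ∧ (j = 0 → q.1 = ⊤ ∧ q.2 = 0)

lemma measurableSet_isJump : MeasurableSet {p : ℕ × ℝ≥0∞ × ℕ | IsJump p.1 p.2} := by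
  unfold IsJump
  have h1 : Measurable fun p : ℕ × ℝ≥0∞ × ℕ => p.1 := by fun_prop
  have h2 : Measurable fun p : ℕ × ℝ≥0∞ × ℕ => p.2.1 := by fun_prop
  have h3 : Measurable fun p : ℕ × ℝ≥0∞ × ℕ => p.2.2 := by fun_prop
  have a1 : MeasurableSet {p : ℕ × ℝ≥0∞ × ℕ | p.1 = 0} := h1 (measurableSet_singleton 0)
  have a2 : MeasurableSet {p : ℕ × ℝ≥0∞ × ℕ | p.2.1 = ⊤} := h2 (measurableSet_singleton _)
  have a3 : MeasurableSet {p : ℕ × ℝ≥0∞ × ℕ | p.2.2 = 0} := h3 (measurableSet_singleton 0)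
  have a4 : MeasurableSet {p : ℕ × ℝ≥0∞ × ℕ | 0 < p.2.1} := measurableSet_lt measurable_const h2
  have a5 : MeasurableSet {p : ℕ × ℝ≥0∞ × ℕ | p.2.2 = p.1 + 1} :=
    measurableSet_eq_fun h3 (by fun_prop)
  have a6 : MeasurableSet {p : ℕ × ℝ≥0∞ × ℕ | p.2.2 + 1 = p.1} :=
    measurableSet_eq_fun (by fun_prop) h1
  exact (a1.compl.imp (a4.inter (a2.compl.inter (a5.union a6)))).inter (a1.imp (a2.inter a3))

lemma ae_isJump_criticalKernel (j : ℕ) : ∀ᵐ q ∂criticalKernel j, IsJump j q := by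
  have hm : MeasurableSet {q : ℝ≥0∞ × ℕ | ¬ IsJump j q} :=
    (measurable_prodMk_left (x := j) measurableSet_isJump).compl
  by_cases hj : j = 0
  · subst hj
    rw [criticalKernel_zero, ae_dirac_iff (p := IsJump 0) hm.of_compl]
    simp [IsJump]
  · rw [ae_iff, ← lintegral_indicator_one hm, lintegral_criticalKernel hj
      (measurable_one.indicator hm)]
    refine (setLIntegral_congr_fun measurableSet_Ioi fun r hr => ?_).trans lintegral_zero
    have hr : (0 : ℝ) < r := hr
    have h1 : (ENNReal.ofReal r, j + 1) ∉ {q : ℝ≥0∞ × ℕ | ¬ IsJump j q} := by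
      simp [IsJump, hj, hr]
    have h2 : (ENNReal.ofReal r, j - 1) ∉ {q : ℝ≥0∞ × ℕ | ¬ IsJump j q} := by
      have : j - 1 + 1 = j := by omega
      simp [IsJump, hj, hr, this]
    rw [Set.indicator_of_notMem h1, Set.indicator_of_notMem h2]
    simp

lemma ae_isJump (hρ : IsChainLaw ρ) :
    ∀ᵐ w ∂ρ, ∀ n, IsJump (w.2 n) (w.1 n, w.2 (n + 1)) := by
  rw [ae_all_iff]
  intro n
  have hm : MeasurableSet {p : ChainSeq × ℝ≥0∞ × ℕ | ¬ IsJump (p.1.2 n) p.2} := by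
    have : Measurable fun p : ChainSeq × ℝ≥0∞ × ℕ => (p.1.2 n, p.2) := by fun_prop
    exact (this measurableSet_isJump).compl
  have hm' : MeasurableSet {w : ChainSeq | ¬ IsJump (w.2 n) (w.1 n, w.2 (n + 1))} := by
    have : Measurable fun w : ChainSeq => (w, w.1 n, w.2 (n + 1)) := by fun_prop
    exact this hm
  have h := hρ n (({p : ChainSeq × ℝ≥0∞ × ℕ | ¬ IsJump (p.1.2 n) p.2}).indicator 1)
    (measurable_one.indicator hm) ?_
  · rw [ae_iff, ← lintegral_indicator_one hm']
    refine h.trans ((lintegral_congr fun w => ?_).trans lintegral_zero)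
    have hw : MeasurableSet {q | ¬ IsJump (w.2 n) q} :=
      (measurable_prodMk_left (x := w.2 n) measurableSet_isJump).compl
    change ∫⁻ q, ({q | ¬ IsJump (w.2 n) q}).indicator 1 q ∂_ = 0
    rw [lintegral_indicator_one hw]
    exact ae_iff.1 (ae_isJump_criticalKernel (w.2 n))
  · intro w q
    have : (truncSeq n w).2 n = w.2 n := if_pos (Nat.lt_succ_self n)
    have hiff : (w, q) ∈ {p : ChainSeq × ℝ≥0∞ × ℕ | ¬ IsJump (p.1.2 n) p.2} ↔
        (truncSeq n w, q) ∈ {p : ChainSeq × ℝ≥0∞ × ℕ | ¬ IsJump (p.1.2 n) p.2} := by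
      simp only [Set.mem_ofPred_eq, this]
    by_cases hq : (w, q) ∈ {p : ChainSeq × ℝ≥0∞ × ℕ | ¬ IsJump (p.1.2 n) p.2}
    · rw [Set.indicator_of_mem hq, Set.indicator_of_mem (hiff.1 hq)]
      rfl
    · rw [Set.indicator_of_notMem hq, Set.indicator_of_notMem (mt hiff.2 hq)]

end

/-- The `n`-th jump is a death. -/
abbrev IsDeath (w : ChainSeq) (n : ℕ) : Prop := w.2 (n + 1) < w.2 n

/-- Sequences of holding times and states which get absorbed in `0` after `m` jumps. -/
structure IsExtinctAt (w : ChainSeq) (m : ℕ) : Prop where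
  isJump : ∀ n, IsJump (w.2 n) (w.1 n, w.2 (n + 1))
  eq_zero : w.2 m = 0
  ne_zero : ∀ n < m, w.2 n ≠ 0

/-- The path `z` is in the state `w.2 n` between the `n`-th and the `n + 1`-st jump time. -/
def IsPathOf (w : ChainSeq) (z : ℝ≥0 → ℕ) : Prop :=
  ∀ (n : ℕ) (t : ℝ≥0), jumpTime w n ≤ t → (t : ℝ≥0∞) < jumpTime w (n + 1) → z t = w.2 n

/-- The `n`-th jump time as a nonnegative real number. -/
noncomputable def jumpTimeNN (w : ChainSeq) (n : ℕ) : ℝ≥0 := (jumpTime w n).toNNReal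

lemma jumpTime_mono (w : ChainSeq) : Monotone (jumpTime w) :=
  monotone_nat_of_le_succ fun n => by rw [jumpTime_succ]; exact le_self_add

namespace IsExtinctAt

variable {w : ChainSeq} {m : ℕ} {z : ℝ≥0 → ℕ}

lemma jumpTime_ne_top (h : IsExtinctAt w m) {n : ℕ} (hn : n ≤ m) : jumpTime w n ≠ ⊤ :=
  ENNReal.sum_ne_top.2 fun k hk =>
    ((h.isJump k).1 (h.ne_zero k ((Finset.mem_range.1 hk).trans_le hn))).2.1

lemma jumpTime_succ_eq_top (h : IsExtinctAt w m) : jumpTime w (m + 1) = ⊤ := by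
  rw [jumpTime_succ, show w.1 m = ⊤ from ((h.isJump m).2 h.eq_zero).1, add_top]

lemma coe_jumpTimeNN (h : IsExtinctAt w m) {n : ℕ} (hn : n ≤ m) :
    (jumpTimeNN w n : ℝ≥0∞) = jumpTime w n :=
  ENNReal.coe_toNNReal (h.jumpTime_ne_top hn)

lemma jumpTime_lt_succ (h : IsExtinctAt w m) {n : ℕ} (hn : n ≤ m) :
    jumpTime w n < jumpTime w (n + 1) := by
  rcases hn.lt_or_eq with hn' | rfl
  · rw [jumpTime_succ]
    exact ENNReal.lt_add_right (h.jumpTime_ne_top hn) ((h.isJump n).1 (h.ne_zero n hn')).1.ne'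
  · rw [h.jumpTime_succ_eq_top]
    exact (h.jumpTime_ne_top le_rfl).lt_top

lemma jumpTimeNN_lt (h : IsExtinctAt w m) {i j : ℕ} (hij : i < j) (hj : j ≤ m) :
    jumpTimeNN w i < jumpTimeNN w j := by
  have hi : i ≤ m := hij.le.trans hj
  rw [← ENNReal.coe_lt_coe, h.coe_jumpTimeNN hi, h.coe_jumpTimeNN hj]
  exact (h.jumpTime_lt_succ hi).trans_le (jumpTime_mono w hij)

lemma state_eq_zero (h : IsExtinctAt w m) {n : ℕ} (hn : m ≤ n) : w.2 n = 0 := by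
  induction n, hn using Nat.le_induction with
  | base => exact h.eq_zero
  | succ n _ ih => exact ((h.isJump n).2 ih).2

lemma lt_of_isDeath (h : IsExtinctAt w m) {n : ℕ} (hn : IsDeath w n) : n < m := by
  by_contra! hle
  rw [IsDeath, h.state_eq_zero hle] at hn
  exact Nat.not_lt_zero _ hn

lemma eq_add_one_iff (h : IsExtinctAt w m) {n : ℕ} (hn : n < m) :
    w.2 n = w.2 (n + 1) + 1 ↔ IsDeath w n := by
  have := ((h.isJump n).1 (h.ne_zero n hn)).2.2
  simp only at this
  unfold IsDeath
  omega

lemma path_eq (h : IsExtinctAt w m) (hz : IsPathOf w z) {n : ℕ} (hn : n ≤ m) :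
    z (jumpTimeNN w n) = w.2 n :=
  hz n _ (h.coe_jumpTimeNN hn).ge (by rw [h.coe_jumpTimeNN hn]; exact h.jumpTime_lt_succ hn)

/-- The death times of an extinct path are the jump times with a downward jump. -/
lemma deathTimes_eq (h : IsExtinctAt w m) (hz : IsPathOf w z) :
    deathTimes z = (fun n => jumpTimeNN w (n + 1)) '' {n | IsDeath w n} := by
  classical
  ext t
  constructor
  · rintro ⟨ht, hev⟩
    have hex : ∃ n, (t : ℝ≥0∞) < jumpTime w (n + 1) :=
      ⟨m, by rw [h.jumpTime_succ_eq_top]; exact ENNReal.coe_lt_top⟩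
    set n := Nat.find hex with hn
    have hlt : (t : ℝ≥0∞) < jumpTime w (n + 1) := Nat.find_spec hex
    have hnm : n ≤ m := Nat.find_min' hex (by
      rw [h.jumpTime_succ_eq_top]; exact ENNReal.coe_lt_top)
    have hge : jumpTime w n ≤ t := by
      rcases Nat.eq_zero_or_pos n with h0 | h0
      · rw [h0]; simp [jumpTime]
      · have := Nat.find_min hex (m := n - 1) (by omega)
        rw [Nat.sub_add_cancel h0] at this
        exact not_lt.1 this
    have hzt := hz n t hge hlt
    obtain ⟨l, hl, hl'⟩ := (mem_nhdsLT_iff_exists_Ioo_subset' ht).1 hev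
    rcases hge.lt_or_eq with hlt' | heq
    · rw [← h.coe_jumpTimeNN hnm, ENNReal.coe_lt_coe] at hlt'
      obtain ⟨s, hs, hst⟩ := exists_between (max_lt hl hlt')
      have h1 : z s = z t + 1 := hl' ⟨(le_max_left _ _).trans_lt hs, hst⟩
      have h2 : z s = w.2 n := hz n s (by
        rw [← h.coe_jumpTimeNN hnm, ENNReal.coe_le_coe]
        exact ((le_max_right _ _).trans_lt hs).le) ((ENNReal.coe_lt_coe.2 hst).trans hlt)
      omega
    · rw [← h.coe_jumpTimeNN hnm, ENNReal.coe_inj] at heq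
      obtain ⟨k, hk⟩ : ∃ k, n = k + 1 := Nat.exists_eq_succ_of_ne_zero fun h0 => by
        rw [h0] at heq
        exact ht.ne' (by rw [← heq]; simp [jumpTimeNN, jumpTime])
      rw [hk] at hnm heq hzt
      refine ⟨k, ?_, heq⟩
      have hkt : jumpTimeNN w k < t := by rw [← heq]; exact h.jumpTimeNN_lt k.lt_succ_self hnm
      obtain ⟨s, hs, hst⟩ := exists_between (max_lt hl hkt)
      have h1 : z s = z t + 1 := hl' ⟨(le_max_left _ _).trans_lt hs, hst⟩
      have h2 : z s = w.2 k := hz k s (by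
        rw [← h.coe_jumpTimeNN (by omega), ENNReal.coe_le_coe]
        exact ((le_max_right _ _).trans_lt hs).le) (by
        rw [← h.coe_jumpTimeNN hnm, heq]; exact ENNReal.coe_lt_coe.2 hst)
      exact (h.eq_add_one_iff hnm).1 (by omega)
  · rintro ⟨n, hn, rfl⟩
    have hnm := h.lt_of_isDeath hn
    have hlt := h.jumpTimeNN_lt n.lt_succ_self hnm
    refine ⟨bot_le.trans_lt hlt, ?_⟩
    filter_upwards [Ioo_mem_nhdsLT hlt] with s hs
    rw [h.path_eq hz hnm, ← (h.eq_add_one_iff hnm).2 hn]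
    refine hz n s ?_ ?_
    · rw [← h.coe_jumpTimeNN hnm.le, ENNReal.coe_le_coe]; exact hs.1.le
    · rw [← h.coe_jumpTimeNN hnm, ENNReal.coe_lt_coe]; exact hs.2

lemma finite_isDeath (h : IsExtinctAt w m) : {n | IsDeath w n}.Finite :=
  (Set.finite_lt_nat m).subset fun _ hn => h.lt_of_isDeath hn

lemma card_isDeath (h : IsExtinctAt w m) :
    h.finite_isDeath.toFinset.card = Nat.count (IsDeath w) m := by
  rw [Nat.count_eq_card_filter_range]
  congr 1
  ext n
  simp only [Set.Finite.mem_toFinset, Set.mem_ofPred_eq, Finset.mem_filter, Finset.mem_range]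
  exact ⟨fun hn => ⟨h.lt_of_isDeath hn, hn⟩, fun hn => hn.2⟩

lemma finite_deathTimes (h : IsExtinctAt w m) (hz : IsPathOf w z) : (deathTimes z).Finite := by
  rw [h.deathTimes_eq hz]
  exact h.finite_isDeath.image _

lemma ncard_deathTimes (h : IsExtinctAt w m) (hz : IsPathOf w z) :
    (deathTimes z).ncard = Nat.count (IsDeath w) m := by
  rw [h.deathTimes_eq hz, Set.InjOn.ncard_image, ← h.card_isDeath,
    Set.ncard_eq_toFinset_card _ h.finite_isDeath]
  intro i hi j hj hij
  have hi := h.lt_of_isDeath hi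
  have hj := h.lt_of_isDeath hj
  rcases lt_trichotomy i j with hlt | heq | hlt
  · exact absurd hij (h.jumpTimeNN_lt (Nat.succ_lt_succ hlt) hj).ne
  · exact heq
  · exact absurd hij (h.jumpTimeNN_lt (Nat.succ_lt_succ hlt) hi).ne'

lemma isDeath_nth (h : IsExtinctAt w m) {k : ℕ} (hk : k < Nat.count (IsDeath w) m) :
    IsDeath w (Nat.nth (IsDeath w) k) :=
  Nat.nth_mem_of_lt_card h.finite_isDeath (by rwa [h.card_isDeath])

lemma count_nth (h : IsExtinctAt w m) {k : ℕ} (hk : k < Nat.count (IsDeath w) m) :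
    Nat.count (IsDeath w) (Nat.nth (IsDeath w) k) = k :=
  Nat.count_nth fun _ => by rwa [h.card_isDeath]

lemma deathTime_succ (h : IsExtinctAt w m) (hz : IsPathOf w z) {k : ℕ}
    (hk : k < Nat.count (IsDeath w) m) :
    deathTime z (k + 1) = jumpTimeNN w (Nat.nth (IsDeath w) k + 1) := by
  have key : ∀ k < Nat.count (IsDeath w) m,
      (∀ n, IsDeath w n → (deathTime z k < jumpTimeNN w (n + 1) ↔ k ≤ Nat.count (IsDeath w) n)) →
      deathTime z (k + 1) = jumpTimeNN w (Nat.nth (IsDeath w) k + 1) := by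
    intro k hk hiff
    have hd := h.isDeath_nth hk
    refine IsLeast.csInf_eq ⟨⟨?_, ?_⟩, ?_⟩
    · rw [h.deathTimes_eq hz]
      exact ⟨_, hd, rfl⟩
    · rw [hiff _ hd, h.count_nth hk]
    · rintro t ⟨ht, hlt⟩
      rw [h.deathTimes_eq hz] at ht
      obtain ⟨n, hn, rfl⟩ := ht
      rw [hiff n hn] at hlt
      have hle : Nat.nth (IsDeath w) k ≤ n := by
        by_contra! hcon
        have := Nat.count_strict_mono (p := IsDeath w) hn hcon
        rw [h.count_nth hk] at this
        omega
      rcases hle.lt_or_eq with h1 | h1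
      · exact (h.jumpTimeNN_lt (Nat.succ_lt_succ h1) (h.lt_of_isDeath hn)).le
      · rw [h1]
  induction k with
  | zero =>
    refine key 0 hk fun n hn => ⟨fun _ => Nat.zero_le _, fun _ => ?_⟩
    exact bot_le.trans_lt (h.jumpTimeNN_lt n.lt_succ_self (h.lt_of_isDeath hn))
  | succ k ih =>
    have hk' : k < Nat.count (IsDeath w) m := by omega
    refine key (k + 1) hk fun n hn => ?_
    rw [ih hk', Nat.succ_le_iff]
    have hd := h.isDeath_nth hk'
    conv_rhs => rw [← h.count_nth hk']
    constructor
    · intro hlt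
      refine Nat.count_strict_mono hd ?_
      by_contra! hcon
      rcases hcon.lt_or_eq with h1 | h1
      · exact hlt.not_gt (h.jumpTimeNN_lt (Nat.succ_lt_succ h1) (h.lt_of_isDeath hd))
      · rw [h1] at hlt; exact hlt.false
    · intro hlt
      refine h.jumpTimeNN_lt (Nat.succ_lt_succ ?_) (h.lt_of_isDeath hn)
      by_contra! hcon
      exact hlt.not_ge (Nat.count_monotone _ hcon)

lemma monotone_deathSequence (h : IsExtinctAt w m) (hz : IsPathOf w z) :
    Monotone (deathSequence z).2 := by
  change Monotone fun k : Fin ((deathTimes z).ncard + 1) => (deathTime z k : ℝ)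
  rw [Fin.monotone_iff_le_succ]
  intro k
  have hk : (k : ℕ) < Nat.count (IsDeath w) m := by rw [← h.ncard_deathTimes hz]; exact k.2
  simp only [Fin.val_castSucc, Fin.val_succ, NNReal.coe_le_coe]
  have hmem : deathTime z (k + 1) ∈ {t | t ∈ deathTimes z ∧ deathTime z k < t} := by
    refine Set.Nonempty.csInf_mem ?_ ((h.finite_deathTimes hz).subset fun t ht => ht.1)
    by_contra hne
    rw [Set.not_nonempty_iff_eq_empty] at hne
    have h1 := h.deathTime_succ hz hk
    rw [deathTime, hne, NNReal.sInf_empty] at h1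
    exact (bot_le.trans_lt (h.jumpTimeNN_lt (Nat.lt_succ_self _)
      (h.lt_of_isDeath (h.isDeath_nth hk)))).ne h1
  exact hmem.2.le

lemma prodAlong_deathSequence (h : IsExtinctAt w m) (hz : IsPathOf w z) (G : ℝ → ℝ≥0∞) :
    prodAlong G (deathSequence z) = G 0 * chainFunctional (fun t => G t.toReal) w := by
  have h1 : prodAlong G (deathSequence z) =
      ∏ k ∈ Finset.range (Nat.count (IsDeath w) m + 1), G (deathTime z k) := by
    rw [← h.ncard_deathTimes hz]
    exact Fin.prod_univ_eq_prod_range (fun k => G (deathTime z k)) _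
  rw [h1, Finset.prod_range_succ', mul_comm, chainFunctional_eq h.eq_zero h.ne_zero]
  congr 1
  have h2 : chainWeight (fun t => G t.toReal) m w =
      ∏ n ∈ (Finset.range m).filter (IsDeath w), G (jumpTimeNN w (n + 1)) := by
    rw [Finset.prod_filter, chainWeight]
    refine Finset.prod_congr rfl fun n hn => ?_
    have hn := Finset.mem_range.1 hn
    simp only [chainW, h.ne_zero n hn, if_false, ← jumpTime_succ]
    rfl
  rw [h2]
  refine Finset.prod_nbij (Nat.nth (IsDeath w)) ?_ ?_ ?_ ?_
  · intro k hk
    have hd := h.isDeath_nth (Finset.mem_range.1 hk)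
    exact Finset.mem_filter.2 ⟨Finset.mem_range.2 (h.lt_of_isDeath hd), hd⟩
  · intro i hi j hj hij
    have hi := h.count_nth (Finset.mem_range.1 hi)
    have hj := h.count_nth (Finset.mem_range.1 hj)
    rw [← hi, hij, hj]
  · intro n hn
    obtain ⟨hnm, hn⟩ := Finset.mem_filter.1 hn
    exact ⟨Nat.count (IsDeath w) n, Finset.mem_coe.2 (Finset.mem_range.2
      (Nat.count_strict_mono hn (Finset.mem_range.1 hnm))), Nat.nth_count hn⟩
  · intro k hk
    rw [h.deathTime_succ hz (Finset.mem_range.1 hk)]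

end IsExtinctAt

/-- The sequence of death times as a measurable function of the holding times and states. -/
noncomputable def deathSeqOf (w : ChainSeq) : FinSeq :=
  ⟨Nat.count (IsDeath w) (sInf {n | w.2 n = 0}), fun k => if (k : ℕ) = 0 then 0 else
    jumpTimeNN w (sInf {n | IsDeath w n ∧ Nat.count (IsDeath w) n + 1 = k} + 1)⟩

lemma measurableSet_isDeath (n : ℕ) : MeasurableSet {w : ChainSeq | IsDeath w n} :=
  measurableSet_lt (by fun_prop) (by fun_prop)

lemma measurable_count_isDeath (n : ℕ) :
    Measurable fun w : ChainSeq => Nat.count (IsDeath w) n := by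
  simp only [Nat.count_eq_card_filter_range, Finset.card_filter]
  exact Finset.measurable_sum _ fun k _ =>
    Measurable.ite (measurableSet_isDeath k) measurable_const measurable_const

lemma measurable_deathSeqOf : Measurable deathSeqOf := by
  refine measurable_sigma_mk (X := fun n => Fin (n + 1) → ℝ)
    (F := fun n w (k : Fin (n + 1)) => if (k : ℕ) = 0 then 0 else
    (jumpTimeNN w (sInf {n | IsDeath w n ∧ Nat.count (IsDeath w) n + 1 = k} + 1) : ℝ)) ?_ ?_
  · have h1 : Measurable fun p : ChainSeq × ℕ => Nat.count (IsDeath p.1) p.2 :=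
      measurable_from_prod_countable_left fun n => measurable_count_isDeath n
    refine h1.comp (measurable_id.prodMk (measurable_nat_sInf fun n => ?_))
    have : Measurable fun w : ChainSeq => w.2 n := by fun_prop
    exact this (measurableSet_singleton 0)
  · intro n
    refine measurable_pi_lambda _ fun k => ?_
    split_ifs
    · exact measurable_const
    · have h1 : Measurable fun p : ChainSeq × ℕ => (jumpTimeNN p.1 (p.2 + 1) : ℝ) :=
        measurable_from_prod_countable_left fun n =>
          (measurable_jumpTime (n + 1)).ennreal_toNNReal.coe_nnreal_real
      refine h1.comp (measurable_id.prodMk (measurable_nat_sInf fun n => ?_))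
      refine (measurableSet_isDeath n).inter ?_
      exact ((measurable_count_isDeath n).add_const 1) (measurableSet_singleton _)

lemma IsExtinctAt.deathSequence_eq {w : ChainSeq} {m : ℕ} {z : ℝ≥0 → ℕ} (h : IsExtinctAt w m)
    (hz : IsPathOf w z) : deathSequence z = deathSeqOf w := by
  have hm : sInf {n | w.2 n = 0} = m :=
    le_antisymm (Nat.sInf_le h.eq_zero) (le_of_not_gt fun hlt =>
      h.ne_zero _ hlt (Nat.sInf_mem (s := {n | w.2 n = 0}) ⟨m, h.eq_zero⟩))
  have hext : ∀ {n n' : ℕ} {a b : ℕ → ℝ}, n = n' → (∀ k ≤ n, a k = b k) →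
      (⟨n, fun k => a k⟩ : FinSeq) = ⟨n', fun k => b k⟩ := by
    rintro n _ a b rfl hab
    have : (fun k : Fin (n + 1) => a k) = fun k : Fin (n + 1) => b k :=
      funext fun k => hab k (Nat.lt_succ_iff.1 k.2)
    rw [this]
  rw [deathSequence, deathSeqOf, hm]
  refine hext (a := fun k => (deathTime z k : ℝ)) (b := fun k => if k = 0 then 0 else
    (jumpTimeNN w (sInf {n | IsDeath w n ∧ Nat.count (IsDeath w) n + 1 = k} + 1) : ℝ))
    (h.ncard_deathTimes hz) fun k hk => ?_
  rw [h.ncard_deathTimes hz] at hk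
  cases k with
  | zero => simp [deathTime]
  | succ k =>
    rw [if_neg k.succ_ne_zero, h.deathTime_succ hz hk]
    have : {n | IsDeath w n ∧ Nat.count (IsDeath w) n + 1 = k + 1} = {Nat.nth (IsDeath w) k} := by
      ext n
      simp only [Set.mem_ofPred_eq, Set.mem_singleton_iff, Nat.succ_inj]
      constructor
      · rintro ⟨hn, rfl⟩
        exact (Nat.nth_count hn).symm
      · rintro rfl
        exact ⟨h.isDeath_nth hk, h.count_nth hk⟩
    rw [this, csInf_singleton]

lemma measurable_chainFunctional {G : ℝ≥0∞ → ℝ≥0∞} (hG : Measurable G) :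
    Measurable (chainFunctional G) := by
  refine Measurable.tsum fun n => (measurable_chainWeight hG n).mul
    (measurable_chainEnd.comp ?_)
  fun_prop

section

variable {Ω : Type*} [MeasurableSpace Ω] {P : Measure Ω} {X : ℕ → Ω → ℝ}

lemma hasLaw_incrementLaw (hX : ∀ i, HasLaw (X i) laplaceMeasure P) (hindep : iIndepFun X P) :
    HasLaw (fun ω i => X i ω) incrementLaw P :=
  hindep.hasLaw_infinitePi hX (aemeasurable_pi_iff.2 fun i => (hX i).aemeasurable)

lemma lintegral_prodAlong_walkOrderStats (hX : HasLaw (fun ω i => X i ω) incrementLaw P)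
    {G : ℝ → ℝ≥0∞} (hG : Measurable G) :
    ∫⁻ ω, prodAlong G (walkOrderStats fun i => X i ω) ∂P = G 0 * walkV G 0 := by
  classical
  have hm := (measurable_prodAlong hG).comp measurable_walkOrderStats
  have h := lintegral_map' (μ := P) (f := prodAlong G ∘ walkOrderStats) hm.aemeasurable
    hX.aemeasurable
  rw [hX.map_eq] at h
  rw [← lintegral_prodAlong_walk hG]
  refine h.symm.trans (lintegral_congr_ae (ae_exists_walk_neg.mono fun x hx => ?_))
  simp only [if_pos hx, Function.comp_apply]

end

section

variable {Ω : Type*} [MeasurableSpace Ω] {Q : Measure Ω} [IsProbabilityMeasure Q]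
  {Z : ℝ≥0 → Ω → ℕ}

/-- A critical binary process with geometric initial law is described by a sequence of holding
times and states which becomes extinct almost surely. -/
lemma exists_chainSeq
    (hZ : IsBirthDeathProcess (fun j => (j : ℝ≥0)) (fun j => (j : ℝ≥0)) Z Q)
    (h0 : ∀ n : ℕ, Q {ω | Z 0 ω = n} = 2⁻¹ ^ (n + 1)) :
    ∃ S : Ω → ChainSeq, AEMeasurable S Q ∧ IsChainLaw (Q.map S) ∧
      (∀ n : ℕ, Q.map S {w | w.2 0 = n} = 2⁻¹ ^ (n + 1)) ∧
      ∀ᵐ ω ∂Q, (∃ m, IsExtinctAt (S ω) m) ∧ IsPathOf (S ω) fun t => Z t ω := by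
  obtain ⟨Y, H, hcond, hpath⟩ := hZ
  set S : Ω → ChainSeq := fun ω => (fun k => H k ω, fun k => Y k ω) with hS
  have hSm : AEMeasurable S Q := aemeasurable_chainSeq hcond
  have hρ : IsChainLaw (Q.map S) := isChainLaw_map hcond
  have := Measure.isProbabilityMeasure_map hSm
  have hjump : ∀ᵐ ω ∂Q, ∀ n, IsJump (Y n ω) (H n ω, Y (n + 1) ω) :=
    ae_of_ae_map hSm (ae_isJump hρ)
  have hZ0 : ∀ᵐ ω ∂Q, Z 0 ω = Y 0 ω := by
    filter_upwards [hjump, hpath] with ω hj hp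
    refine hp 0 0 (by simp) ?_
    simp only [zero_add, Finset.range_one, Finset.sum_singleton, ENNReal.coe_zero]
    by_cases hY : Y 0 ω = 0
    · rw [show H 0 ω = ⊤ from ((hj 0).2 hY).1]
      exact ENNReal.zero_lt_top
    · exact ((hj 0).1 hY).1
  have h0' : ∀ n : ℕ, Q.map S {w | w.2 0 = n} = 2⁻¹ ^ (n + 1) := by
    intro n
    have hm : MeasurableSet {w : ChainSeq | w.2 0 = n} := by
      have : Measurable fun w : ChainSeq => w.2 0 := by fun_prop
      exact this (measurableSet_singleton n)
    rw [Measure.map_apply_of_aemeasurable hSm hm, ← h0 n]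
    refine measure_congr (hZ0.mono fun ω hω => ?_)
    change (Y 0 ω = n) = (Z 0 ω = n)
    rw [hω]
  refine ⟨S, hSm, hρ, h0', ?_⟩
  classical
  filter_upwards [hjump, hpath, ae_of_ae_map hSm (ae_exists_eq_zero hρ h0')] with ω hj hp he
  exact ⟨⟨Nat.find he, hj, Nat.find_spec he, fun n hn => Nat.find_min he hn⟩, hp⟩

end

end LaplaceWalk

theorem mainTheorem6 {Ω : Type*} [MeasurableSpace Ω] (P : Measure Ω) [IsProbabilityMeasure P]
    (X : ℕ → Ω → ℝ) (hX : ∀ i, HasLaw (X i) LaplaceWalk.laplaceMeasure P)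
    (hindep : iIndepFun X P) :
    -- the first descending ladder time is almost surely finite
    (∀ᵐ ω ∂P, ∃ k : ℕ, LaplaceWalk.walk (fun i => X i ω) k < 0) ∧
    -- identity in law with the successive death times of the critical binary process
    (∀ {Ω' : Type*} [MeasurableSpace Ω'] (Q : Measure Ω') [IsProbabilityMeasure Q]
      (Z : ℝ≥0 → Ω' → ℕ),
      LaplaceWalk.IsBirthDeathProcess (fun j => (j : ℝ≥0)) (fun j => (j : ℝ≥0)) Z Q →
      (∀ n : ℕ, Q {ω | Z 0 ω = n} = 2⁻¹ ^ (n + 1)) →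
      (∀ᵐ ω ∂Q, (LaplaceWalk.deathTimes fun t => Z t ω).Finite) ∧
      IdentDistrib (fun ω => LaplaceWalk.walkOrderStats fun i => X i ω)
        (fun ω => LaplaceWalk.deathSequence fun t => Z t ω) P Q) ∧
    -- the law of the maximum
    (∀ t : ℝ, 0 < t →
      P {ω | t < LaplaceWalk.maxOrderStat fun i => X i ω} = ENNReal.ofReal (1 / (2 + t))) := by
  have hlaw := LaplaceWalk.hasLaw_incrementLaw hX hindep
  refine ⟨?_, ?_, fun t ht => ?_⟩
  · refine ae_of_ae_map hlaw.aemeasurable (p := fun x => ∃ k, LaplaceWalk.walk x k < 0) ?_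
    rw [hlaw.map_eq]
    exact LaplaceWalk.ae_exists_walk_neg
  · intro Ω' _ Q _ Z hZ h0
    obtain ⟨S, hSm, hρ, h0', hS⟩ := LaplaceWalk.exists_chainSeq hZ h0
    have hW : AEMeasurable (fun ω => LaplaceWalk.walkOrderStats fun i => X i ω) P :=
      LaplaceWalk.measurable_walkOrderStats.comp_aemeasurable hlaw.aemeasurable
    have hD : AEMeasurable (fun ω => LaplaceWalk.deathSequence fun t => Z t ω) Q := by
      refine (LaplaceWalk.measurable_deathSeqOf.comp_aemeasurable hSm).congr (hS.mono ?_)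
      rintro ω ⟨⟨m, hm⟩, hp⟩
      exact (hm.deathSequence_eq hp).symm
    refine ⟨hS.mono fun ω h => ?_, hW, hD, ?_⟩
    · obtain ⟨⟨m, hm⟩, hp⟩ := h
      exact hm.finite_deathTimes hp
    · have := Measure.isProbabilityMeasure_map hW
      have := Measure.isProbabilityMeasure_map hD
      have hmono : MeasurableSet {e : LaplaceWalk.FinSeq | Monotone e.2} :=
        LaplaceWalk.isClosed_monotone.measurableSet
      refine LaplaceWalk.measure_ext_of_prodAlong ?_ ?_ fun g hg => ?_
      · exact (ae_map_iff hW hmono).2 (Eventually.of_forall fun ω =>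
          LaplaceWalk.monotone_walkOrderStats _)
      · refine (ae_map_iff hD hmono).2 (hS.mono ?_)
        rintro ω ⟨⟨m, hm⟩, hp⟩
        exact hm.monotone_deathSequence hp
      · obtain ⟨u, hu, hu01, hu0⟩ := LaplaceWalk.exists_riccati_walkV hg
        have hgm := hg.1.measurable
        have hG : Measurable fun x => ENNReal.ofReal (g x) := by fun_prop
        have hG' : Measurable fun t : ℝ≥0∞ => ENNReal.ofReal (g t.toReal) := by fun_prop
        have hF := LaplaceWalk.measurable_chainFunctional hG'
        have hFS := hF.comp_aemeasurable hSm
        simp only [Function.comp_def] at hFS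
        have hPm := LaplaceWalk.measurable_prodAlong hG
        rw [lintegral_map' hPm.aemeasurable hW, lintegral_map' hPm.aemeasurable hD,
          LaplaceWalk.lintegral_prodAlong_walkOrderStats hlaw hG, hu0,
          ← LaplaceWalk.lintegral_chainFunctional hρ h0' hg hu hu01,
          lintegral_map' hF.aemeasurable hSm, ← lintegral_const_mul'' _ hFS]
        refine lintegral_congr_ae (hS.mono ?_)
        rintro ω ⟨⟨m, hm⟩, hp⟩
        exact (hm.prodAlong_deathSequence hp fun x => ENNReal.ofReal (g x)).symm
  · have hm : MeasurableSet {x | t < LaplaceWalk.maxOrderStat x} :=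
      measurableSet_lt measurable_const LaplaceWalk.measurable_maxOrderStat
    rw [← LaplaceWalk.measure_lt_maxOrderStat ht, ← hlaw.map_eq,
      Measure.map_apply_of_aemeasurable hlaw.aemeasurable hm]
    rfl
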